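/- Let $\mathbb{T}=\mathbb{R}/\mathbb{Z}$, $\Omega=\mathbb{R}\times\mathbb{T}$, and let $W(z)=\frac12(1-|z|^2)^2$ for $z\in\mathbb{R}^2$. Let $a,b\in\mathbb{R}$ with $a^2+b^2=1$ and put $u^\pm=(a,\pm b)$, so that $W(u^\pm)=0$. Let $\mathcal{A}$ be the set of all maps $u\in H^1_{loc}(\Omega,\mathbb{R}^2)$ with $\nabla u\in L^2(\Omega,\mathbb{R}^{2\times 2})$ and $\nabla\cdot u=0$ in $\Omega$ whose average $\overline u(x_1)=\int_{\mathbb{T}}u(x_1,x_2)\,dx_2$ (a continuous function of $x_1$) satisfies $\overline u(x_1)\to u^\pm$ as $x_1\to\pm\infty$. For $u\in\mathcal{A}$ let $$E(u)=\int_\Omega \tfrac12|\nabla u|^2+W(u)\,dx\in[0,+\infty].$$ A global minimizer of $(\mathcal{P})$ is a map $u\in\mathcal{A}$ with $E(u)\le E(v)$ for all $v\in\mathcal{A}$. Consider also the one-dimensional problem of minimizing $\int_{\mathbb{R}}\frac12|\dot\gamma|^2+W(\gamma)\,dt$ over all continuous curves $\gamma\in H^1_{loc}(\mathbb{R},\mathbb{R}^2)$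 with $\dot\gamma\in L^2(\mathbb{R})$, $\gamma_1\equiv a$ and $\gamma(t)\to u^\pm$ as $t\to\pm\infty$. Then the one-dimensional problem has a minimizer $g$, it is of class $\mathcal{C}^2(\mathbb{R},\mathbb{R}^2)$, and it is unique up to translation: every minimizer of the one-dimensional problem is of the form $t\mapsto g(t+\tau)$ for some $\tau\in\mathbb{R}$. Moreover, every global minimizer $u$ of $(\mathcal{P})$ is one-dimensional: there is $\tau\in\mathbb{R}$ such that $u(x)=g(x_1+\tau)$ for almost every $x=(x_1,x_2)\in\Omega$. -/

import Mathlib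

open MeasureTheory Filter Topology
open scoped ContDiff ENNReal

namespace Layer

/-- The target plane with its Euclidean norm; coordinate `0` is the first one, `1` the second. -/
abbrev Plane : Type := EuclideanSpace ℝ (Fin 2)

/-- The infinite cylinder `ℝ × (ℝ/ℤ)`; its `volume` is the product of Lebesgue measure and the
Haar measure of total mass one. -/
abbrev Cylinder : Type := ℝ × UnitAddCircle

/-- The lift of a map on the cylinder to its universal cover (`1`-periodic in the second
variable). -/
def lift (f : Cylinder → Plane) : ℝ × ℝ → Plane :=
  fun x => f (x.1, (x.2 : UnitAddCircle))

/-- `g` is the weak (distributional) derivative of `f` in the direction `e`, on `V = ℝ` or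
`V = ℝ × ℝ`. -/
def IsWeakDeriv {V : Type*} [NormedAddCommGroup V] [NormedSpace ℝ V] [MeasureSpace V]
    (e : V) (f g : V → Plane) : Prop :=
  LocallyIntegrable f volume ∧ LocallyIntegrable g volume ∧
    ∀ φ : V → ℝ, ContDiff ℝ ∞ φ → HasCompactSupport φ →
      ∫ x, (fderiv ℝ φ x e) • f x = - ∫ x, φ x • g x

/-! ### Maps on the cylinder -/

/-- `D 0` and `D 1` are the weak partial derivatives `∂₁ u` and `∂₂ u` on the cylinder. As the
cylinder is locally isometric to its universal cover, this is tested on the lifts. -/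
def IsWeakGradient (u : Cylinder → Plane) (D : Fin 2 → Cylinder → Plane) : Prop :=
  IsWeakDeriv ((1, 0) : ℝ × ℝ) (lift u) (lift (D 0)) ∧
    IsWeakDeriv ((0, 1) : ℝ × ℝ) (lift u) (lift (D 1))

open Classical in
/-- The weak gradient of `u` (unique up to null sets), and `0` if there is none. -/
noncomputable def weakGradient (u : Cylinder → Plane) : Fin 2 → Cylinder → Plane :=
  if h : ∃ D, IsWeakGradient u D then Classical.choose h else 0

/-- The maps `u ∈ H¹_loc` on the cylinder with `∇ u ∈ L²` and `∇ · u = 0`. -/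
def MemHDotDiv (u : Cylinder → Plane) : Prop :=
  (∀ K : Set Cylinder, IsCompact K → MemLp u 2 (volume.restrict K)) ∧
    (∃ D, IsWeakGradient u D) ∧
    (∀ j, MemLp (weakGradient u j) 2 volume) ∧
    ∀ᵐ x : Cylinder, weakGradient u 0 x 0 + weakGradient u 1 x 1 = 0

/-- The average over the periodic variable. -/
noncomputable def average (u : Cylinder → Plane) : ℝ → Plane :=
  fun t => ∫ y : UnitAddCircle, u (t, y)

/-- The average, taken as a continuous function of `x₁`, tends to `um` at `-∞` and to `up`
at `+∞`. -/
def HasEndStates (u : Cylinder → Plane) (um up : Plane) : Prop :=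
  ∃ c : ℝ → Plane, Continuous c ∧ c =ᵐ[volume] average u ∧
    Tendsto c atBot (𝓝 um) ∧ Tendsto c atTop (𝓝 up)

/-- `E(u) = ∫ ½ |∇u|² + W(u)` over the cylinder, in `[0, ∞]`, for a nonnegative `W`. -/
noncomputable def energy (W : Plane → ℝ) (u : Cylinder → Plane) : ℝ≥0∞ :=
  ∫⁻ x : Cylinder, ENNReal.ofReal
    ((1 / 2) * (‖weakGradient u 0 x‖ ^ 2 + ‖weakGradient u 1 x‖ ^ 2) + W (u x))

/-- Competitors of the minimization problem on the cylinder. -/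
def IsAdmissible (um up : Plane) (u : Cylinder → Plane) : Prop :=
  MemHDotDiv u ∧ HasEndStates u um up

/-- Global minimizers of the energy among divergence-free maps connecting `um` to `up`. -/
def IsGlobalMinimizer (W : Plane → ℝ) (um up : Plane) (u : Cylinder → Plane) : Prop :=
  IsAdmissible um up u ∧ ∀ v, IsAdmissible um up v → energy W u ≤ energy W v

/-! ### One-dimensional maps -/

open Classical in
/-- The weak derivative of a curve (unique up to null sets), and `0` if there is none. -/
noncomputable def weakDeriv (γ : ℝ → Plane) : ℝ → Plane :=
  if h : ∃ v, IsWeakDeriv (1 : ℝ) γ v then Classical.choose h else 0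

/-- Curves `γ` in `H¹_loc(ℝ)`, given by their continuous representative, with `γ' ∈ L²(ℝ)`, with
values in the line `{z | z₁ = a}` and with limits `um` at `-∞` and `up` at `+∞`. -/
def IsAdmissible1D (a : ℝ) (um up : Plane) (γ : ℝ → Plane) : Prop :=
  Continuous γ ∧ (∃ v, IsWeakDeriv (1 : ℝ) γ v) ∧ MemLp (weakDeriv γ) 2 volume ∧
    (∀ t, γ t 0 = a) ∧ Tendsto γ atBot (𝓝 um) ∧ Tendsto γ atTop (𝓝 up)

/-- `∫ ½ |γ'|² + W(γ)` over `ℝ`, in `[0, ∞]`, for a nonnegative `W`. -/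
noncomputable def energy1D (W : Plane → ℝ) (γ : ℝ → Plane) : ℝ≥0∞ :=
  ∫⁻ t : ℝ, ENNReal.ofReal ((1 / 2) * ‖weakDeriv γ t‖ ^ 2 + W (γ t))

/-- Minimizers of the one-dimensional problem on the line `{z | z₁ = a}`. -/
def IsMinimizer1D (W : Plane → ℝ) (a : ℝ) (um up : Plane) (γ : ℝ → Plane) : Prop :=
  IsAdmissible1D a um up γ ∧ ∀ η, IsAdmissible1D a um up η → energy1D W γ ≤ energy1D W η

/-- The Ginzburg–Landau (Aviles–Giga) potential `W(z) = ½ (1 - |z|²)²`. -/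
noncomputable def glPotential (z : Plane) : ℝ := (1 / 2) * (1 - ‖z‖ ^ 2) ^ 2

end Layer

/-!
Write `u = (u₁, u₂)`, `ρ = 1 - |u|²`, and let `s = ±1` be such that `s b = |b|`. For a
divergence-free map the energy density can be written pointwise as

  `½ (∂₁u₂ + ∂₂u₁ - s ρ)² + 2 (∂₁u₁)² + s ρ (∂₁u₂ + ∂₂u₁) + det ∇u`.

The last two terms are null Lagrangians. Since `∇ · u = 0`, the third one is `s` times the divergence
of the Jin–Kohn entropy, whose first component is `Φ(u) = u₂ (1 - u₁² - u₂²/3)`; its integral is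
`s (Φ(a, b) - Φ(a, -b)) = 4/3 |b|³` (`integral_entropy_production`). The Jacobian determinant
integrates to `0` (`integral_jacobian`). Hence `E(u) ≥ 4/3 |b|³`, and the curve
`(a, b tanh (|b| t))`, extended constantly in `x₂`, attains this value (`energy_lower_bound`,
`layerCurve_admissible_energy`). If equality holds, both squares vanish: `∂₁u₁ = ∂₂u₂ = 0` and
`∂₁u₂ + ∂₂u₁ = s ρ`. Then `u₂` is a function of `x₁` only, the mean and the mean square of `u₁` over
the circle are constant, and averaging the second equation gives an autonomous ODE for `u₂`. Its
behaviour at `+∞` forces `u₁ = a`, and uniqueness for the ODE gives a translate of the curve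
(`rigidity`). The one-dimensional problem needs no separate argument: extension by a constant in `x₂`
preserves admissibility and energy, so it inherits both the lower bound and its equality case.

No smooth approximation is used. Integrating the weak derivative against a moving test function shows
that Sobolev functions are absolutely continuous on almost every line
(`IsWeakDerivReal.hasACDeriv_lines`), so the chain and product rules are used line by line.
Boundary terms at infinity are controlled on slices `{x₁ = t}` on which `∫ |∂₂u|²` is small: there `u`
is uniformly close to its mean (`frequently_slice_close`). The Jacobian needs one more idea, because
the product `u₁ ∂₂u₂` cannot be differentiated in `x₁`. The correlation
`J(r) = ∫ ∂₁u₁(x) ∂₂u₂(x + r e₂) - ∂₁u₂(x) ∂₂u₁(x - r e₂)` is continuous in `r`, and its integral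
over `[0, h]` is a finite-difference Jacobian, which is, up to rotations of the circle, the
`x₁`-derivative of `u₁(x) (u₂(x + h e₂) - u₂(x))`. Thus `∫₀ʰ J = 0` for all `h`, and `J(0) = 0`.
-/

namespace Layer

/-! ### Absolutely continuous functions on the line -/

/-- The function `f` agrees almost everywhere with a locally absolutely continuous function whose
derivative is `f'`. -/
def HasACDeriv (f f' : ℝ → ℝ) : Prop :=
  LocallyIntegrable f' volume ∧ ∃ c : ℝ, ∀ᵐ t, f t = c + ∫ r in (0 : ℝ)..t, f' r

/-- `g` is the weak derivative in the direction `e` of the real-valued function `f`. -/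
def IsWeakDerivReal {V : Type*} [NormedAddCommGroup V] [NormedSpace ℝ V] [MeasureSpace V]
    (e : V) (f g : V → ℝ) : Prop :=
  LocallyIntegrable f volume ∧ LocallyIntegrable g volume ∧
    ∀ φ : V → ℝ, ContDiff ℝ ∞ φ → HasCompactSupport φ →
      ∫ x, (fderiv ℝ φ x e) * f x = - ∫ x, φ x * g x

lemma _root_.MeasureTheory.LocallyIntegrable.intervalIntegrable {f : ℝ → ℝ}
    (hf : LocallyIntegrable f volume) (a b : ℝ) : IntervalIntegrable f volume a b :=
  (hf.integrableOn_isCompact isCompact_uIcc).intervalIntegrable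

namespace HasACDeriv

variable {f f' g g' : ℝ → ℝ}

/-- The double almost-everywhere form does not refer to the choice of the representative. -/
lemma sub_eq (hf : HasACDeriv f f') :
    ∀ᵐ s, ∀ᵐ t, f t - f s = ∫ r in s..t, f' r := by
  obtain ⟨hi, c, hc⟩ := hf
  filter_upwards [hc] with s hs
  filter_upwards [hc] with t ht
  rw [hs, ht, ← intervalIntegral.integral_add_adjacent_intervals
    (hi.intervalIntegrable 0 s) (hi.intervalIntegrable s t)]
  ring

lemma congr (hf : HasACDeriv f f') (h : f =ᵐ[volume] g) (h' : f' =ᵐ[volume] g') :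
    HasACDeriv g g' := by
  obtain ⟨hi, c, hc⟩ := hf
  refine ⟨hi.congr h', c, ?_⟩
  filter_upwards [hc, h] with t ht ht'
  rw [← ht', ht]
  congr 1
  refine intervalIntegral.integral_congr_ae ?_
  filter_upwards [h'] with r hr _ using hr

lemma const (c : ℝ) : HasACDeriv (fun _ => c) (fun _ => 0) :=
  ⟨locallyIntegrable_const 0, c, by simp⟩

lemma add (hf : HasACDeriv f f') (hg : HasACDeriv g g') :
    HasACDeriv (fun t => f t + g t) (fun t => f' t + g' t) := by
  obtain ⟨hi, c, hc⟩ := hf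
  obtain ⟨hj, d, hd⟩ := hg
  refine ⟨hi.add hj, c + d, ?_⟩
  filter_upwards [hc, hd] with t h1 h2
  rw [intervalIntegral.integral_add (hi.intervalIntegrable _ _) (hj.intervalIntegrable _ _), h1, h2]
  ring

lemma const_mul (k : ℝ) (hf : HasACDeriv f f') :
    HasACDeriv (fun t => k * f t) (fun t => k * f' t) := by
  obtain ⟨hi, c, hc⟩ := hf
  refine ⟨hi.smul k, k * c, ?_⟩
  filter_upwards [hc] with t h1
  rw [intervalIntegral.integral_const_mul, h1]
  ring

lemma sub (hf : HasACDeriv f f') (hg : HasACDeriv g g') :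
    HasACDeriv (fun t => f t - g t) (fun t => f' t - g' t) := by
  have := hf.add (hg.const_mul (-1))
  simpa [sub_eq_add_neg] using this

/-- The absolutely continuous representative. -/
lemma continuous_primitive (hf : LocallyIntegrable f' volume) (c : ℝ) :
    Continuous fun t => c + ∫ r in (0 : ℝ)..t, f' r :=
  continuous_const.add
    (intervalIntegral.continuous_primitive (fun a b => hf.intervalIntegrable a b) 0)

/-- The Leibniz rule. -/
lemma mul (hf : HasACDeriv f f') (hg : HasACDeriv g g') :
    HasACDeriv (fun t => f t * g t) (fun t => f' t * g t + f t * g' t) := by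
  obtain ⟨hi, c, hc⟩ := hf
  obtain ⟨hj, d, hd⟩ := hg
  set F : ℝ → ℝ := fun t => c + ∫ r in (0 : ℝ)..t, f' r with hF
  set G : ℝ → ℝ := fun t => d + ∫ r in (0 : ℝ)..t, g' r with hG
  have hFc : Continuous F := continuous_primitive hi c
  have hGc : Continuous G := continuous_primitive hj d
  -- integration by parts applies to the absolutely continuous representatives
  have key : HasACDeriv (fun t => F t * G t) (fun t => f' t * G t + F t * g' t) := by
    refine ⟨(hi.mul_continuous hGc).add (hj.continuous_mul hFc), c * d, .of_forall fun t => ?_⟩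
    have hac : ∀ {k : ℝ → ℝ} (hk : LocallyIntegrable k volume) (e : ℝ),
        AbsolutelyContinuousOnInterval (fun t => e + ∫ r in (0 : ℝ)..t, k r) 0 t := fun hk e =>
      (LipschitzWith.const e).lipschitzOnWith.absolutelyContinuousOnInterval.fun_add
        ((hk.intervalIntegrable 0 t).absolutelyContinuousOnInterval_intervalIntegral (by simp))
    have h := (hac hi c).integral_deriv_mul_eq_sub (hac hj d)
    have hcongr : ∫ r in (0 : ℝ)..t, (f' r * G r + F r * g' r) =
        ∫ r in (0 : ℝ)..t, (deriv F r * G r + F r * deriv G r) := by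
      refine intervalIntegral.integral_congr_ae ?_
      filter_upwards [_root_.LocallyIntegrable.ae_hasDerivAt_integral hi,
        _root_.LocallyIntegrable.ae_hasDerivAt_integral hj] with r h1 h2 _
      rw [((h1 0).const_add c).deriv, ((h2 0).const_add d).deriv]
    rw [hcongr, h]
    simp [hF, hG]
  refine key.congr ?_ ?_
  · filter_upwards [hc, hd] with t h1 h2
    rw [h1, h2]
  · filter_upwards [hc, hd] with t h1 h2
    rw [h1, h2]

/-- If a locally absolutely continuous function with integrable derivative comes arbitrarily close
to `L` and `M` near `-∞` and `+∞`, then the integral of its derivative is `M - L`. -/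
lemma integral_eq_sub (hf : HasACDeriv f f') (hi : Integrable f' volume) {L M : ℝ}
    (hL : ∀ ε > 0, ∃ᶠ t in atBot ⊓ ae volume, |f t - L| < ε)
    (hM : ∀ ε > 0, ∃ᶠ t in atTop ⊓ ae volume, |f t - M| < ε) :
    ∫ t, f' t = M - L := by
  obtain ⟨-, c, hc⟩ := hf
  have lim : ∀ {l : Filter ℝ} {A B : ℝ}, Tendsto (fun t => ∫ r in (0 : ℝ)..t, f' r) l (𝓝 A) →
      (∀ ε > 0, ∃ᶠ t in l ⊓ ae volume, |f t - B| < ε) → c + A = B := by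
    intro l A B hA hB
    have hA' : Tendsto f (l ⊓ ae volume) (𝓝 (c + A)) :=
      ((hA.const_add c).mono_left inf_le_left).congr'
        (by filter_upwards [mem_inf_of_right hc] with t ht using ht.symm)
    refine eq_of_abs_sub_eq_zero ?_
    refine le_antisymm (le_of_forall_pos_lt_add fun ε hε => ?_) (abs_nonneg _)
    have h1 : ∀ᶠ t in l ⊓ ae volume, |f t - (c + A)| < ε / 2 :=
      (Metric.tendsto_nhds.1 hA' _ (half_pos hε))
    obtain ⟨t, ht, ht'⟩ := ((hB _ (half_pos hε)).and_eventually h1).exists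
    rw [abs_lt] at *
    constructor <;> linarith [ht.1, ht.2, ht'.1, ht'.2]
  have h1 := lim (intervalIntegral_tendsto_integral_Ioi 0 hi.integrableOn tendsto_id) hM
  have h2 : c + -∫ r in Set.Iic (0 : ℝ), f' r = L := by
    refine lim ?_ hL
    simp_rw [intervalIntegral.integral_symm _ (0 : ℝ)]
    exact (intervalIntegral_tendsto_integral_Iic 0 hi.integrableOn tendsto_id).neg
  rw [← intervalIntegral.integral_Iic_add_Ioi hi.integrableOn hi.integrableOn (b := 0)]
  linarith

lemma of_contDiff {φ : ℝ → ℝ} (hφ : ContDiff ℝ 1 φ) : HasACDeriv φ (deriv φ) := by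
  have hc : Continuous (deriv φ) := hφ.continuous_deriv le_rfl
  refine ⟨hc.locallyIntegrable, φ 0, .of_forall fun t => ?_⟩
  rw [intervalIntegral.integral_deriv_eq_sub (fun x _ => (hφ.differentiable (by simp)) x)
    (hc.intervalIntegrable _ _)]
  ring

/-- Limits at `+∞` of functions that are only defined almost everywhere are taken along
`atTop ⊓ ae volume`, and are unique because this filter is nontrivial. -/
instance : (atTop ⊓ ae (volume : Measure ℝ)).NeBot := by
  refine inf_neBot_iff.2 fun {s} hs {t} ht => ?_
  obtain ⟨N, hN⟩ := mem_atTop_sets.1 hs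
  by_contra h
  rw [Set.not_nonempty_iff_eq_empty] at h
  have : Set.Ici N ⊆ tᶜ := fun x hx hxt => by
    have : x ∈ s ∩ t := ⟨hN x hx, hxt⟩
    rw [h] at this; exact this
  have h0 := measure_mono_null this (mem_ae_iff.1 ht)
  simp at h0

instance : (atBot ⊓ ae (volume : Measure ℝ)).NeBot := by
  refine inf_neBot_iff.2 fun {s} hs {t} ht => ?_
  obtain ⟨N, hN⟩ := mem_atBot_sets.1 hs
  by_contra h
  rw [Set.not_nonempty_iff_eq_empty] at h
  have : Set.Iic N ⊆ tᶜ := fun x hx hxt => by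
    have : x ∈ s ∩ t := ⟨hN x hx, hxt⟩
    rw [h] at this; exact this
  have h0 := measure_mono_null this (mem_ae_iff.1 ht)
  simp at h0

lemma frequently_of_tendsto {l : Filter ℝ} [(l ⊓ ae (volume : Measure ℝ)).NeBot] {L : ℝ}
    (h : Tendsto f l (𝓝 L)) (ε : ℝ) (hε : 0 < ε) :
    ∃ᶠ t in l ⊓ ae volume, |f t - L| < ε :=
  ((Metric.tendsto_nhds.1 h ε hε).filter_mono inf_le_left).frequently

lemma integral_eq_sub_of_tendsto (hf : HasACDeriv f f') (hi : Integrable f' volume) {L M : ℝ}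
    (hL : Tendsto f atBot (𝓝 L)) (hM : Tendsto f atTop (𝓝 M)) : ∫ t, f' t = M - L :=
  hf.integral_eq_sub hi (frequently_of_tendsto hL) (frequently_of_tendsto hM)

lemma locallyIntegrable (hf : HasACDeriv f f') : LocallyIntegrable f volume := by
  obtain ⟨hi, c, hc⟩ := hf
  exact (continuous_primitive hi c).locallyIntegrable.congr (hc.mono fun t ht => ht.symm)

/-- Absolutely continuous functions satisfy the integration by parts formula that defines weak
derivatives. -/
lemma isWeakDerivReal (hf : HasACDeriv f f') : IsWeakDerivReal (1 : ℝ) f f' := by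
  refine ⟨hf.locallyIntegrable, hf.1, fun φ hφ hs => ?_⟩
  have hd : Continuous (deriv φ) := hφ.continuous_deriv (by simp)
  have h1 : Integrable (fun t => deriv φ t * f t) :=
    hf.locallyIntegrable.integrable_smul_left_of_hasCompactSupport hd hs.deriv
  have h2 : Integrable (fun t => φ t * f' t) :=
    hf.1.integrable_smul_left_of_hasCompactSupport hφ.continuous hs
  have h3 := ((of_contDiff (hφ.of_le (by simp))).mul hf).integral_eq_sub_of_tendsto (h1.add h2)
    (L := 0) (M := 0) ?_ ?_
  · rw [integral_add h1 h2] at h3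
    simp only [fderiv_apply_one_eq_deriv]
    linarith
  all_goals
    have h0 := hasCompactSupport_iff_eventuallyEq.1 hs
    rw [coclosedCompact_eq_cocompact, cocompact_eq_atBot_atTop, EventuallyEq,
      eventually_sup] at h0
    refine tendsto_const_nhds.congr' ?_
    first
    | filter_upwards [h0.1] with t ht
      rw [ht, Pi.zero_apply, zero_mul]
    | filter_upwards [h0.2] with t ht
      rw [ht, Pi.zero_apply, zero_mul]

end HasACDeriv

/-! ### Shears and Fubini's theorem -/

lemma locallyIntegrable_comp_snd {X : Type*} [TopologicalSpace X] [MeasurableSpace X]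
    {μ : Measure X} [SFinite μ] {f : X → ℝ} (hf : LocallyIntegrable f μ) (ν : Measure ℝ)
    [IsLocallyFiniteMeasure ν] [SFinite ν] :
    LocallyIntegrable (fun p : ℝ × X => f p.2) (ν.prod μ) := by
  rintro ⟨r, x⟩
  obtain ⟨U, hU, hfU⟩ := hf x
  obtain ⟨I, hI, hIfin⟩ := ν.finiteAt_nhds r
  refine ⟨I ×ˢ U, prod_mem_nhds hI hU, ?_⟩
  rw [IntegrableOn, ← Measure.prod_restrict]
  have : IsFiniteMeasure (ν.restrict I) := ⟨by simpa using hIfin⟩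
  exact Integrable.comp_snd hfU _

section Shear

variable {G : Type*} [AddCommGroup G] [TopologicalSpace G] [IsTopologicalAddGroup G]
  [MeasurableSpace G] [BorelSpace G] [SecondCountableTopology G] {μ : Measure G} [SFinite μ]
  [μ.IsAddRightInvariant]

/-- The shear `(r, x) ↦ (r, x + γ r)` preserves the product measure. -/
lemma measurePreserving_shear (ν : Measure ℝ) [SFinite ν] {γ : ℝ → G} (hγ : Continuous γ) :
    MeasurePreserving (fun p : ℝ × G => (p.1, p.2 + γ p.1)) (ν.prod μ) (ν.prod μ) := by
  refine (MeasurePreserving.id ν).skew_product (g := fun r x => x + γ r) ?_ ?_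
  · exact (continuous_snd.add (hγ.comp continuous_fst)).measurable
  · exact .of_forall fun r => map_add_right_eq_self μ (γ r)

lemma locallyIntegrable_shear {f : G → ℝ} (hf : LocallyIntegrable f μ) (ν : Measure ℝ)
    [IsLocallyFiniteMeasure ν] [SFinite ν] {γ : ℝ → G} (hγ : Continuous γ) :
    LocallyIntegrable (fun p : ℝ × G => f (p.2 + γ p.1)) (ν.prod μ) := by
  let e : ℝ × G ≃ₜ ℝ × G :=
    { toFun := fun p => (p.1, p.2 + γ p.1)
      invFun := fun p => (p.1, p.2 - γ p.1)
      left_inv := fun p => by simp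
      right_inv := fun p => by simp
      continuous_toFun := by fun_prop
      continuous_invFun := by fun_prop }
  have h := locallyIntegrable_comp_snd hf ν
  rw [← (measurePreserving_shear (μ := μ) ν hγ).map_eq] at h
  exact (locallyIntegrable_map_homeomorph e).1 h

end Shear

section Fubini

variable {X : Type*} [MeasurableSpace X] {μ : Measure X} [SFinite μ]

lemma integrable_intervalIntegral {k : ℝ × X → ℝ} {a b : ℝ}
    (hk : Integrable k ((volume.restrict (Set.uIoc a b)).prod μ)) :
    Integrable (fun x => ∫ r in a..b, k (r, x)) μ := by
  simp_rw [intervalIntegral.intervalIntegral_eq_integral_uIoc, smul_eq_mul]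
  exact hk.integral_prod_right.const_mul _

lemma intervalIntegrable_integral {k : ℝ × X → ℝ} {a b : ℝ}
    (hk : Integrable k ((volume.restrict (Set.uIoc a b)).prod μ)) :
    IntervalIntegrable (fun r => ∫ x, k (r, x) ∂μ) volume a b :=
  intervalIntegrable_iff.2 hk.integral_prod_left

variable [TopologicalSpace X]

lemma integrable_strip {k : ℝ × X → ℝ} (hk : LocallyIntegrable k (volume.prod μ)) {a b : ℝ}
    {K : Set X} (hK : IsCompact K) (h0 : ∀ r ∈ Set.uIcc a b, ∀ x ∉ K, k (r, x) = 0) :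
    Integrable k ((volume.restrict (Set.uIoc a b)).prod μ) := by
  have h1 : IntegrableOn k (Set.uIcc a b ×ˢ K) (volume.prod μ) :=
    hk.integrableOn_isCompact (isCompact_uIcc.prod hK)
  have h2 : IntegrableOn k (Set.uIcc a b ×ˢ Set.univ) (volume.prod μ) := by
    refine h1.of_forall_sdiff_eq_zero (measurableSet_uIcc.prod .univ) ?_
    rintro ⟨r, x⟩ ⟨⟨hr, -⟩, hx⟩
    exact h0 r hr x fun hxK => hx ⟨hr, hxK⟩
  have h3 := h2.mono_set (Set.prod_mono_left (Set.uIoc_subset_uIcc (a := a) (b := b)))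
  rwa [IntegrableOn, ← Measure.prod_restrict, Measure.restrict_univ] at h3

lemma locallyIntegrable_intervalIntegral [LocallyCompactSpace X] {k : ℝ × X → ℝ}
    (hk : LocallyIntegrable k (volume.prod μ)) (a b : ℝ) :
    LocallyIntegrable (fun x => ∫ r in a..b, k (r, x)) μ := by
  refine locallyIntegrable_iff.2 fun K hK => integrable_intervalIntegral ?_
  have h := (hk.integrableOn_isCompact ((isCompact_uIcc (a := a) (b := b)).prod hK)).mono_set
    (Set.prod_mono_left Set.uIoc_subset_uIcc)
  rwa [IntegrableOn, ← Measure.prod_restrict] at h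

end Fubini

/-! ### Weak derivatives and absolute continuity on lines -/

section WeakDeriv

variable {V : Type*} [NormedAddCommGroup V] [NormedSpace ℝ V] [MeasureSpace V] [BorelSpace V]
  [FiniteDimensional ℝ V] [(volume : Measure V).IsAddHaarMeasure] {e : V} {f g : V → ℝ}

/-- For a fixed `s`, the increment of a function over `s • e` is almost everywhere the integral of its
weak derivative. Tested against `φ`, this is the definition of the weak derivative for the
translates of `φ`, integrated over `[0, s]`. -/
lemma IsWeakDerivReal.translate (h : IsWeakDerivReal e f g) (s : ℝ) :
    ∀ᵐ x, f (x + s • e) - f x = ∫ r in (0 : ℝ)..s, g (x + r • e) := by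
  have := FiniteDimensional.proper ℝ V
  have : SecondCountableTopology V := secondCountable_of_proper
  obtain ⟨hf, hg, hw⟩ := h
  have hγ : Continuous fun r : ℝ => r • e := by fun_prop
  have hshear : LocallyIntegrable (fun p : ℝ × V => g (p.2 + p.1 • e)) (volume.prod volume) :=
    locallyIntegrable_shear hg volume hγ
  have hfs : LocallyIntegrable (fun x => f (x + s • e)) volume := by
    have := (locallyIntegrable_map_homeomorph (Homeomorph.addRight (s • e)) (f := f)
      (μ := (volume : Measure V))).1 (by simpa [map_add_right_eq_self] using hf)
    exact this
  refine ae_eq_of_integral_contDiff_smul_eq (hfs.sub hf)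
    (locallyIntegrable_intervalIntegral hshear 0 s) fun φ hφ hφs => ?_
  simp only [smul_eq_mul]
  have hdφ : ∀ x r, HasDerivAt (fun r : ℝ => φ (x - r • e)) (-(fderiv ℝ φ (x - r • e) e)) r := by
    intro x r
    have h1 : HasFDerivAt φ (fderiv ℝ φ (x - r • e)) (x - r • e) :=
      (hφ.differentiable (by simp) _).hasFDerivAt
    have h2 : HasDerivAt (fun r : ℝ => x - r • e) (-e) r := by
      simpa using ((hasDerivAt_id r).smul_const e).const_sub x
    simpa [Function.comp_def] using! h1.comp_hasDerivAt r h2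
  have hdc : Continuous fun x => fderiv ℝ φ x e :=
    (hφ.continuous_fderiv (by simp)).clm_apply continuous_const
  set ψ : V → ℝ := fun x => fderiv ℝ φ x e with hψ
  have hψs : HasCompactSupport ψ := hφs.fderiv_apply (𝕜 := ℝ) e
  -- moving the test function by `r • e` keeps its support in a fixed compact set
  set K : Set V := (fun p : ℝ × V => p.2 + p.1 • e) '' (Set.uIcc 0 s ×ˢ tsupport ψ) with hKdef
  have hK : IsCompact K := (isCompact_uIcc.prod hψs).image (by fun_prop)
  have hint1 : Integrable (fun p : ℝ × V => ψ (p.2 - p.1 • e) * f p.2)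
      ((volume.restrict (Set.uIoc 0 s)).prod volume) := by
    refine integrable_strip ((locallyIntegrable_comp_snd hf volume).continuous_mul
      (by fun_prop)) hK fun r hr x hx => ?_
    have : x - r • e ∉ tsupport ψ := fun h => hx ⟨(r, x - r • e), ⟨hr, h⟩, by simp⟩
    simp [image_eq_zero_of_notMem_tsupport this]
  have hint2 : Integrable (fun p : ℝ × V => φ p.2 * g (p.2 + p.1 • e))
      ((volume.restrict (Set.uIoc 0 s)).prod volume) := by
    refine integrable_strip (hshear.continuous_mul (hφ.continuous.comp continuous_snd)) hφs
      fun r _ x hx => ?_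
    simp [image_eq_zero_of_notMem_tsupport hx]
  have hφ1 : Integrable (fun x => φ x * f (x + s • e)) :=
    hfs.integrable_smul_left_of_hasCompactSupport hφ.continuous hφs
  have hφ2 : Integrable (fun x => φ x * f x) :=
    hf.integrable_smul_left_of_hasCompactSupport hφ.continuous hφs
  have hφ3 : Integrable (fun x => φ (x - s • e) * f x) := by
    have := hφ1.comp_sub_right (s • e)
    simpa using this
  calc ∫ x, φ x * (f (x + s • e) - f x)
      = (∫ x, φ x * f (x + s • e)) - ∫ x, φ x * f x := by
        rw [← integral_sub hφ1 hφ2]; simp_rw [mul_sub]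
    _ = (∫ x, φ (x - s • e) * f x) - ∫ x, φ x * f x := by
        congr 1
        rw [← integral_sub_right_eq_self _ (s • e)]; simp
    _ = ∫ x, -∫ r in (0 : ℝ)..s, ψ (x - r • e) * f x := by
        rw [← integral_sub hφ3 hφ2]
        refine integral_congr_ae (.of_forall fun x => ?_)
        have := intervalIntegral.integral_eq_sub_of_hasDerivAt (fun r _ => hdφ x r)
          ((hdc.comp (by fun_prop : Continuous fun r : ℝ => x - r • e)).neg.intervalIntegrable 0 s)
        simp only [intervalIntegral.integral_neg, zero_smul, sub_zero] at this
        simp only [intervalIntegral.integral_mul_const]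
        rw [← neg_mul, this]; ring
    _ = -∫ r in (0 : ℝ)..s, ∫ x, ψ (x - r • e) * f x := by
        rw [integral_neg, intervalIntegral_integral_swap (f := fun r x => ψ (x - r • e) * f x) hint1]
    _ = ∫ r in (0 : ℝ)..s, ∫ x, φ x * g (x + r • e) := by
        rw [← intervalIntegral.integral_neg]
        refine intervalIntegral.integral_congr fun r _ => ?_
        have h1 := hw (fun x => φ (x - r • e)) (hφ.comp (contDiff_id.sub contDiff_const))
          (hφs.comp_homeomorph (Homeomorph.subRight (r • e)))
        simp only [fderiv_comp_sub] at h1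
        rw [h1, neg_neg, ← integral_add_right_eq_self _ (r • e)]
        simp
    _ = ∫ x, φ x * ∫ r in (0 : ℝ)..s, g (x + r • e) := by
        rw [intervalIntegral_integral_swap (f := fun r x => φ x * g (x + r • e)) hint2]
        simp_rw [intervalIntegral.integral_const_mul]

end WeakDeriv

lemma ae_ae_swap {X Y : Type*} [MeasurableSpace X] [MeasurableSpace Y] {μ : Measure X}
    {ν : Measure Y} [SFinite μ] [SFinite ν] {p : X × Y → Prop} (h : ∀ᵐ z ∂μ.prod ν, p z) :
    ∀ᵐ y ∂ν, ∀ᵐ x ∂μ, p (x, y) := by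
  rw [← Measure.prod_swap] at h
  exact Measure.ae_ae_of_ae_prod (ae_of_ae_map measurable_swap.aemeasurable h)

/-- Exchange of almost-everywhere quantifiers for the zero set of a measurable function. -/
lemma ae_ae_eq_zero_comm {X Y : Type*} [MeasurableSpace X] [MeasurableSpace Y] {μ : Measure X}
    {ν : Measure Y} [SFinite μ] [SFinite ν] {k : X × Y → ℝ}
    (hk : AEStronglyMeasurable k (μ.prod ν)) (h : ∀ᵐ x ∂μ, ∀ᵐ y ∂ν, k (x, y) = 0) :
    ∀ᵐ z ∂μ.prod ν, k z = 0 := by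
  have h1 : ∀ᵐ x ∂μ, ∀ᵐ y ∂ν, hk.mk k (x, y) = 0 := by
    filter_upwards [h, Measure.ae_ae_of_ae_prod hk.ae_eq_mk] with x hx hx'
    filter_upwards [hx, hx'] with y hy hy'
    rw [← hy', hy]
  have hm : MeasurableSet {z | hk.mk k z = 0} :=
    hk.stronglyMeasurable_mk.measurable (measurableSet_singleton 0)
  filter_upwards [(Measure.ae_prod_iff_ae_ae hm).2 h1, hk.ae_eq_mk] with z hz hz'
  rw [hz', hz]

/-- The substitution `r = t r'` fixes the domain of integration, so that measurability in the
endpoint follows from that of parametric integrals. -/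
lemma stronglyMeasurable_intervalIntegral {X : Type*} [MeasurableSpace X] {k : ℝ × X → ℝ}
    (hk : StronglyMeasurable k) :
    StronglyMeasurable fun p : ℝ × X => ∫ r in (0 : ℝ)..p.1, k (r, p.2) := by
  have h1 : ∀ p : ℝ × X, ∫ r in (0 : ℝ)..p.1, k (r, p.2) =
      p.1 * ∫ r in (0 : ℝ)..1, k (p.1 * r, p.2) := by
    intro p
    have := intervalIntegral.smul_integral_comp_mul_left (a := 0) (b := 1)
      (fun r => k (r, p.2)) p.1
    simpa using this.symm
  simp_rw [h1, intervalIntegral.integral_of_le zero_le_one]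
  refine measurable_fst.stronglyMeasurable.mul ?_
  have : StronglyMeasurable fun q : (ℝ × X) × ℝ => k (q.1.1 * q.2, q.1.2) :=
    hk.comp_measurable (by fun_prop)
  exact this.integral_prod_right'

lemma locallyIntegrable_slice {X : Type*} [TopologicalSpace X] [MeasurableSpace X] [BorelSpace X]
    {μ : Measure X} [SFinite μ] [SecondCountableTopology X] [LocallyCompactSpace X] [T2Space X]
    [IsFiniteMeasureOnCompacts μ]
    {k : ℝ × X → ℝ} (hk : LocallyIntegrable k (volume.prod μ)) :
    ∀ᵐ x ∂μ, LocallyIntegrable (fun r => k (r, x)) volume := by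
  have : ∀ n : ℕ, ∀ᵐ x ∂μ, IntegrableOn (fun r => k (r, x)) (Set.Icc (-n) n) volume := by
    intro n
    have h1 : ∀ m, ∀ᵐ x ∂μ.restrict (compactCovering X m),
        IntegrableOn (fun r => k (r, x)) (Set.Icc (-n) n) volume := by
      intro m
      have h2 := hk.integrableOn_isCompact
        ((isCompact_Icc (a := (-n : ℝ)) (b := n)).prod (isCompact_compactCovering X m))
      rw [IntegrableOn, ← Measure.prod_restrict] at h2
      exact h2.prod_left_ae
    rw [← ae_restrict_iUnion_iff, iUnion_compactCovering, Measure.restrict_univ] at h1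
    exact h1
  filter_upwards [ae_all_iff.2 this] with x hx
  refine locallyIntegrable_iff.2 fun K hK => ?_
  obtain ⟨R, hR⟩ := hK.isBounded.subset_closedBall 0
  obtain ⟨n, hn⟩ := exists_nat_ge R
  refine (hx n).mono_set (hR.trans ?_)
  rw [Real.closedBall_eq_Icc]
  exact Set.Icc_subset_Icc (by linarith) (by linarith)

lemma HasACDeriv.of_comp_add {f f' : ℝ → ℝ} (a : ℝ)
    (h : HasACDeriv (fun s => f (a + s)) (fun s => f' (a + s))) : HasACDeriv f f' := by
  obtain ⟨hi, c, hc⟩ := h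
  have hi' : LocallyIntegrable f' volume := by
    have := (locallyIntegrable_map_homeomorph (Homeomorph.addLeft a) (f := f')
      (μ := (volume : Measure ℝ))).2 hi
    simpa [map_add_left_eq_self] using this
  refine ⟨hi', c - ∫ r in (0 : ℝ)..a, f' r, ?_⟩
  have := (quasiMeasurePreserving_add_left volume (-a)).ae hc
  filter_upwards [this] with t ht
  rw [add_neg_cancel_left, intervalIntegral.integral_comp_add_left (fun r => f' r) a] at ht
  rw [ht, add_zero, add_neg_cancel_left, ← intervalIntegral.integral_add_adjacent_intervals
    (hi'.intervalIntegrable 0 a) (hi'.intervalIntegrable a t)]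
  ring

section WeakDeriv

variable {V : Type*} [NormedAddCommGroup V] [NormedSpace ℝ V] [MeasureSpace V] [BorelSpace V]
  [FiniteDimensional ℝ V] [(volume : Measure V).IsAddHaarMeasure] {e : V} {f g : V → ℝ}

/-- A weakly differentiable function is absolutely continuous on almost every line. By Fubini's
theorem, the formula for each single increment `s` turns into one for almost every `s` on almost
every line. -/
lemma IsWeakDerivReal.hasACDeriv_lines (h : IsWeakDerivReal e f g) :
    ∀ᵐ x, HasACDeriv (fun s : ℝ => f (x + s • e)) (fun s => g (x + s • e)) := by
  have := FiniteDimensional.proper ℝ V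
  have : SecondCountableTopology V := secondCountable_of_proper
  have hγ : Continuous fun r : ℝ => r • e := by fun_prop
  have hgs : LocallyIntegrable (fun p : ℝ × V => g (p.2 + p.1 • e)) (volume.prod volume) :=
    locallyIntegrable_shear h.2.1 volume hγ
  have hfs : LocallyIntegrable (fun p : ℝ × V => f (p.2 + p.1 • e)) (volume.prod volume) :=
    locallyIntegrable_shear h.1 volume hγ
  have hf0 := locallyIntegrable_comp_snd h.1 (volume : Measure ℝ)
  -- a measurable version of `g` along lines makes the exceptional set measurable
  obtain ⟨k, hk, hgk⟩ := hgs.aestronglyMeasurable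
  have hgk' : ∀ᵐ x : V, ∀ᵐ s : ℝ, g (x + s • e) = k (s, x) := ae_ae_swap hgk
  have hkint : ∀ᵐ x : V, ∀ s : ℝ,
      ∫ r in (0 : ℝ)..s, g (x + r • e) = ∫ r in (0 : ℝ)..s, k (r, x) := by
    filter_upwards [hgk'] with x hx s
    refine intervalIntegral.integral_congr_ae ?_
    filter_upwards [hx] with r hr _ using hr
  have h0 : ∀ᵐ z : ℝ × V, f (z.2 + z.1 • e) - f z.2 - ∫ r in (0 : ℝ)..z.1, k (r, z.2) = 0 := by
    refine ae_ae_eq_zero_comm ((hfs.aestronglyMeasurable.sub hf0.aestronglyMeasurable).sub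
      (stronglyMeasurable_intervalIntegral hk).aestronglyMeasurable) (.of_forall fun s => ?_)
    filter_upwards [h.translate s, hkint] with x hx hx'
    rw [hx, hx', sub_self]
  filter_upwards [locallyIntegrable_slice hgs, ae_ae_swap h0, hkint] with x h1 h2 h3
  refine ⟨h1, f x, ?_⟩
  filter_upwards [h2] with s hs
  rw [h3]
  linarith

end WeakDeriv

/-- On the line, weakly differentiable functions are absolutely continuous. -/
lemma IsWeakDerivReal.hasACDeriv {f f' : ℝ → ℝ} (h : IsWeakDerivReal (1 : ℝ) f f') :
    HasACDeriv f f' := by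
  obtain ⟨a, ha⟩ := h.hasACDeriv_lines.exists
  simp only [smul_eq_mul, mul_one] at ha
  exact ha.of_comp_add a

/-- The exchange of the partial derivative in the first variable with integration over the
second one. It holds in the weak sense by Fubini's theorem. -/
lemma hasACDeriv_integral {X : Type*} [TopologicalSpace X] [MeasurableSpace X] [BorelSpace X]
    [CompactSpace X] [T2Space X] {μ : Measure X} [IsFiniteMeasure μ] {F F' : ℝ × X → ℝ}
    (hF : LocallyIntegrable F (volume.prod μ)) (hF' : LocallyIntegrable F' (volume.prod μ))
    (h : ∀ᵐ x ∂μ, HasACDeriv (fun t => F (t, x)) (fun t => F' (t, x))) :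
    HasACDeriv (fun t => ∫ x, F (t, x) ∂μ) (fun t => ∫ x, F' (t, x) ∂μ) := by
  have hloc : ∀ {k : ℝ × X → ℝ}, LocallyIntegrable k (volume.prod μ) →
      LocallyIntegrable (fun t => ∫ x, k (t, x) ∂μ) volume := by
    intro k hk
    refine locallyIntegrable_iff.2 fun K hK => ?_
    have h1 : IntegrableOn k (K ×ˢ Set.univ) (volume.prod μ) :=
      hk.integrableOn_isCompact (hK.prod isCompact_univ)
    rw [IntegrableOn, ← Measure.prod_restrict, Measure.restrict_univ] at h1
    exact h1.integral_prod_left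
  have hswap : ∀ {k : ℝ × X → ℝ}, LocallyIntegrable k (volume.prod μ) → ∀ {φ : ℝ → ℝ},
      Continuous φ → HasCompactSupport φ →
      ∫ t, φ t * ∫ x, k (t, x) ∂μ = ∫ x, (∫ t, φ t * k (t, x)) ∂μ := by
    intro k hk φ hφ hs
    have h1 : Integrable (fun p : ℝ × X => φ p.1 * k p) (volume.prod μ) := by
      have h2 : IntegrableOn (fun p : ℝ × X => φ p.1 * k p) (tsupport φ ×ˢ Set.univ)
          (volume.prod μ) :=
        (hk.integrableOn_isCompact (hs.isCompact.prod isCompact_univ)).continuousOn_mul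
          (by fun_prop) (hs.isCompact.prod isCompact_univ)
      rw [← integrableOn_univ]
      refine h2.of_forall_sdiff_eq_zero .univ ?_
      rintro ⟨t, x⟩ ⟨-, hx⟩
      rw [image_eq_zero_of_notMem_tsupport (f := φ), zero_mul]
      exact fun ht => hx ⟨ht, trivial⟩
    simp_rw [← integral_const_mul]
    exact integral_integral_swap (f := fun t x => φ t * k (t, x)) h1
  refine IsWeakDerivReal.hasACDeriv ⟨hloc hF, hloc hF', fun φ hφ hs => ?_⟩
  simp only [fderiv_apply_one_eq_deriv]
  rw [hswap hF (hφ.continuous_deriv (by simp)) hs.deriv, hswap hF' hφ.continuous hs,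
    ← integral_neg]
  refine integral_congr_ae ?_
  filter_upwards [h] with x hx
  simpa only [fderiv_apply_one_eq_deriv] using hx.isWeakDerivReal.2.2 φ hφ hs

/-! ### The circle and the cylinder -/

/-- The representative in `(0, 1]` of a point of the circle. -/
noncomputable def circleSection (y : UnitAddCircle) : ℝ := AddCircle.equivIoc 1 0 y

lemma coe_circleSection (y : UnitAddCircle) : ((circleSection y : ℝ) : UnitAddCircle) = y :=
  (AddCircle.equivIoc (1 : ℝ) 0).symm_apply_apply y

lemma circleSection_mem (y : UnitAddCircle) : circleSection y ∈ Set.Ioc (0 : ℝ) 1 := by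
  have h : circleSection y ∈ Set.Ioc (0 : ℝ) (0 + 1) := (AddCircle.equivIoc (1 : ℝ) 0 y).2
  rwa [zero_add] at h

lemma quasiMeasurePreserving_circleSection :
    Measure.QuasiMeasurePreserving circleSection volume volume := by
  have h1 := (AddCircle.measurePreserving_equivIoc 1 (a := 0)).quasiMeasurePreserving
  have h2 : Measure.QuasiMeasurePreserving (Subtype.val : Set.Ioc (0 : ℝ) (0 + 1) → ℝ)
      (Measure.comap Subtype.val volume) volume :=
    ⟨measurable_subtype_coe, by
      rw [map_comap_subtype_coe measurableSet_Ioc]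
      exact Measure.restrict_le_self.absolutelyContinuous⟩
  exact h2.comp h1

/-- Almost-everywhere statements about lifts descend to the circle. -/
lemma ae_circle_of_ae_real {p : UnitAddCircle → Prop} (h : ∀ᵐ r : ℝ, p r) :
    ∀ᵐ y : UnitAddCircle, p y := by
  filter_upwards [quasiMeasurePreserving_circleSection.ae h] with y hy
  rwa [coe_circleSection] at hy

lemma ae_cylinder_of_ae_plane {p : Cylinder → Prop} (h : ∀ᵐ z : ℝ × ℝ, p (z.1, z.2)) :
    ∀ᵐ x : Cylinder, p x := by
  have h1 : Measure.QuasiMeasurePreserving (Prod.map id circleSection)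
      ((volume : Measure ℝ).prod (volume : Measure UnitAddCircle))
      ((volume : Measure ℝ).prod (volume : Measure ℝ)) :=
    MeasureTheory.QuasiMeasurePreserving.prodMap (Measure.QuasiMeasurePreserving.id volume)
      quasiMeasurePreserving_circleSection
  filter_upwards [h1.ae h] with x hx
  simpa [coe_circleSection] using hx

/-- The integral over the circle of the derivative of a function vanishes. -/
lemma HasACDeriv.integral_circle_eq_zero {q q' : UnitAddCircle → ℝ}
    (h : HasACDeriv (fun r : ℝ => q r) (fun r : ℝ => q' r)) : ∫ y, q' y = 0 := by
  obtain ⟨hi, c, hc⟩ := h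
  have h1 := (quasiMeasurePreserving_add_right volume (1 : ℝ)).ae hc
  obtain ⟨t, ht, ht'⟩ := (hc.and h1).exists
  have h2 := intervalIntegral.integral_add_adjacent_intervals
    (hi.intervalIntegrable 0 t) (hi.intervalIntegrable t (t + 1))
  rw [← UnitAddCircle.intervalIntegral_preimage t]
  have h3 : (((t + 1 : ℝ)) : UnitAddCircle) = (t : UnitAddCircle) := by
    rw [AddCircle.coe_add, AddCircle.coe_period, add_zero]
  simp only [h3] at ht ht'
  linarith

/-- A function on the circle differs from its mean by at most the integral of its derivative. -/
lemma HasACDeriv.abs_sub_integral_circle_le {q q' : UnitAddCircle → ℝ}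
    (h : HasACDeriv (fun r : ℝ => q r) (fun r : ℝ => q' r)) (hq : Integrable q) :
    ∀ᵐ y, |q y - ∫ z, q z| ≤ ∫ z, |q' z| := by
  have hi := h.1
  have h1 : ∀ᵐ y : UnitAddCircle, ∀ᵐ z : UnitAddCircle, |q y - q z| ≤ ∫ z, |q' z| := by
    filter_upwards [quasiMeasurePreserving_circleSection.ae h.sub_eq] with y hy
    filter_upwards [quasiMeasurePreserving_circleSection.ae hy] with z hz
    rw [coe_circleSection, coe_circleSection] at hz
    rw [abs_sub_comm, hz, ← UnitAddCircle.integral_preimage 0, zero_add]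
    have hy1 := circleSection_mem y
    have hz1 := circleSection_mem z
    rw [← Real.norm_eq_abs]
    refine intervalIntegral.norm_integral_le_integral_norm_uIoc.trans ?_
    refine setIntegral_mono_set ?_ (.of_forall fun _ => norm_nonneg _) ?_
    · exact ((hi.integrableOn_isCompact isCompact_Icc).mono_set Set.Ioc_subset_Icc_self).norm
    · refine LE.le.eventuallyLE fun x hx => ?_
      rw [Set.mem_uIoc] at hx
      rcases hx with hx | hx
      · exact ⟨hy1.1.trans hx.1, hx.2.trans hz1.2⟩
      · exact ⟨hz1.1.trans hx.1, hx.2.trans hy1.2⟩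
  filter_upwards [h1] with y hy
  have h2 : q y - ∫ z, q z = ∫ z, (q y - q z) := by
    rw [integral_sub (integrable_const _) hq]
    simp [measureReal_def]
  rw [h2, ← Real.norm_eq_abs]
  refine (norm_integral_le_of_norm_le_const (C := ∫ z, |q' z|) ?_).trans ?_
  · simpa using hy
  · simp [measureReal_def]

/-- An integrable function takes small values on every neighbourhood of a filter whose members have
infinite measure. -/
lemma frequently_lt_of_integrable {l : Filter ℝ} (hl : ∀ S ∈ l, volume S = ⊤) {h : ℝ → ℝ}
    (hi : Integrable h) {ε : ℝ} (hε : 0 < ε) : ∃ᶠ t in l ⊓ ae volume, h t < ε := by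
  intro hn
  obtain ⟨S, hS, T, hT, hST⟩ := mem_inf_iff_superset.1 hn
  have h1 : volume S ≤ volume {t | ε ≤ ‖h t‖} := by
    refine measure_mono_ae ?_
    filter_upwards [hT] with t ht htS
    have : ¬ h t < ε := hST ⟨htS, ht⟩
    exact (not_lt.1 this).trans (le_abs_self _)
  rw [hl S hS] at h1
  exact absurd (h1.trans_lt (hi.measure_norm_ge_lt_top hε)) (lt_irrefl _)

lemma volume_eq_top_of_mem_atTop (S : Set ℝ) (hS : S ∈ (atTop : Filter ℝ)) : volume S = ⊤ := by
  obtain ⟨N, hN⟩ := mem_atTop_sets.1 hS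
  exact top_le_iff.1 (Real.volume_Ici (a := N) ▸ measure_mono hN)

lemma volume_eq_top_of_mem_atBot (S : Set ℝ) (hS : S ∈ (atBot : Filter ℝ)) : volume S = ⊤ := by
  obtain ⟨N, hN⟩ := mem_atBot_sets.1 hS
  exact top_le_iff.1 (Real.volume_Iic (a := N) ▸ measure_mono hN)

/-- The functions `f₁` and `f₂` are the partial derivatives of `f` on the cylinder, in the sense of
absolute continuity along almost every line. Functions on a vertical circle are lifted to the line.
The field `translate` is the form of `snd` in which the increment is fixed before the point. -/
structure HasACGradient (f f₁ f₂ : Cylinder → ℝ) : Prop where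
  fst : ∀ᵐ y : UnitAddCircle, HasACDeriv (fun t => f (t, y)) (fun t => f₁ (t, y))
  snd : ∀ᵐ t : ℝ, HasACDeriv (fun r : ℝ => f (t, r)) (fun r : ℝ => f₂ (t, r))
  translate : ∀ h : ℝ, ∀ᵐ x : Cylinder,
    f (x.1, x.2 + h) - f x = ∫ r in (0 : ℝ)..h, f₂ (x.1, x.2 + (r : UnitAddCircle))

lemma IsWeakDeriv.coord {V : Type*} [NormedAddCommGroup V] [NormedSpace ℝ V] [MeasureSpace V]
    [OpensMeasurableSpace V] {e : V} {F G : V → Plane} (h : IsWeakDeriv e F G) (i : Fin 2) :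
    IsWeakDerivReal e (fun x => F x i) (fun x => G x i) := by
  obtain ⟨hF, hG, hw⟩ := h
  let P : Plane →L[ℝ] ℝ := EuclideanSpace.proj i
  have hP : ∀ {k : V → Plane}, LocallyIntegrable k volume →
      LocallyIntegrable (fun x => k x i) volume := fun hk x => by
      obtain ⟨U, hU, hk'⟩ := hk x
      exact ⟨U, hU, P.integrable_comp hk'⟩
  refine ⟨hP hF, hP hG, fun φ hφ hs => ?_⟩
  have h1 : Integrable fun x => (fderiv ℝ φ x e) • F x :=
    hF.integrable_smul_left_of_hasCompactSupport
      ((hφ.continuous_fderiv (by simp)).clm_apply continuous_const) (hs.fderiv_apply (𝕜 := ℝ) e)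
  have h2 : Integrable fun x => φ x • G x :=
    hG.integrable_smul_left_of_hasCompactSupport hφ.continuous hs
  have h3 := congrArg P (hw φ hφ hs)
  rw [map_neg, ← P.integral_comp_comm h1, ← P.integral_comp_comm h2] at h3
  simpa [P] using h3

lemma IsWeakGradient.hasACGradient {u : Cylinder → Plane} {D : Fin 2 → Cylinder → Plane}
    (h : IsWeakGradient u D) (i : Fin 2) :
    HasACGradient (fun x => u x i) (fun x => D 0 x i) (fun x => D 1 x i) := by
  have h1 := h.1.coord i
  have h2 := h.2.coord i
  refine ⟨?_, ?_, fun s => ?_⟩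
  · have := ae_ae_swap (μ := (volume : Measure ℝ)) (ν := (volume : Measure ℝ)) h1.hasACDeriv_lines
    refine ae_circle_of_ae_real ?_
    filter_upwards [this] with y hy
    obtain ⟨x, hx⟩ := hy.exists
    simp only [lift, Prod.mk_add_mk, Prod.smul_mk, smul_eq_mul, mul_one, mul_zero, add_zero] at hx
    exact hx.of_comp_add x
  · have := Measure.ae_ae_of_ae_prod (μ := (volume : Measure ℝ)) (ν := (volume : Measure ℝ))
      h2.hasACDeriv_lines
    filter_upwards [this] with x hx
    obtain ⟨y, hy⟩ := hx.exists
    simp only [lift, Prod.mk_add_mk, Prod.smul_mk, smul_eq_mul, mul_one, mul_zero, add_zero] at hy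
    exact hy.of_comp_add (f := fun r : ℝ => u (x, r) i) (f' := fun r : ℝ => D 1 (x, r) i) y
  · refine ae_cylinder_of_ae_plane ?_
    filter_upwards [h2.translate s] with z hz
    simpa [lift] using hz

/-! ### Local integrability on the cylinder -/

/-- The function `f` is locally square integrable on the cylinder. -/
def LocSq (f : Cylinder → ℝ) : Prop :=
  AEStronglyMeasurable f volume ∧ LocallyIntegrable (fun x => f x ^ 2) volume

namespace LocSq

variable {f g : Cylinder → ℝ}

lemma mul (hf : LocSq f) (hg : LocSq g) : LocallyIntegrable (fun x => f x * g x) volume := by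
  refine (hf.2.add hg.2).mono (hf.1.mul hg.1) (.of_forall fun x => ?_)
  simp only [Pi.add_apply]
  rw [Real.norm_eq_abs, Real.norm_eq_abs, abs_mul]
  refine le_trans ?_ (le_abs_self _)
  nlinarith [sq_nonneg (|f x| - |g x|), sq_abs (f x), sq_abs (g x)]

lemma const (c : ℝ) : LocSq fun _ => c :=
  ⟨aestronglyMeasurable_const, locallyIntegrable_const _⟩

lemma locallyIntegrable (hf : LocSq f) : LocallyIntegrable f volume := by
  simpa using hf.mul (const 1)

lemma of_memLp (hf : MemLp f 2 volume) : LocSq f :=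
  ⟨hf.1, hf.integrable_sq.locallyIntegrable⟩

lemma sub (hf : LocSq f) (hg : LocSq g) : LocSq fun x => f x - g x := by
  refine ⟨hf.1.sub hg.1, ?_⟩
  refine (((hf.2.add hg.2).sub ((hf.mul hg).smul (2 : ℝ)))).congr (.of_forall fun x => ?_)
  simp only [Pi.add_apply, Pi.sub_apply, Pi.smul_apply, smul_eq_mul]
  ring

end LocSq

instance : (volume : Measure Cylinder).IsAddLeftInvariant :=
  Measure.prod.instIsAddLeftInvariant

instance : (volume : Measure Cylinder).IsAddRightInvariant :=
  ⟨fun g => by simp_rw [add_comm _ g]; exact map_add_left_eq_self volume g⟩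

lemma measurePreserving_rotate (h : UnitAddCircle) :
    MeasurePreserving (fun x : Cylinder => ((x.1, x.2 + h) : Cylinder)) volume volume := by
  have := measurePreserving_add_right (volume : Measure Cylinder) ((0, h) : Cylinder)
  convert this using 2 with x
  simp [Prod.ext_iff]

lemma locallyIntegrable_rotate {f : Cylinder → ℝ} (hf : LocallyIntegrable f volume)
    (h : UnitAddCircle) : LocallyIntegrable (fun x : Cylinder => f (x.1, x.2 + h)) volume := by
  have := (locallyIntegrable_map_homeomorph (Homeomorph.addRight ((0, h) : Cylinder)) (f := f)
      (μ := (volume : Measure Cylinder))).1 (by simpa [map_add_right_eq_self] using hf)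
  simpa [Function.comp_def, Prod.add_def] using this

lemma LocSq.rotate {f : Cylinder → ℝ} (hf : LocSq f) (h : UnitAddCircle) :
    LocSq fun x : Cylinder => f (x.1, x.2 + h) :=
  ⟨hf.1.comp_measurePreserving (measurePreserving_rotate h), locallyIntegrable_rotate hf.2 h⟩

lemma ae_integrable_circle {E : Type*} [NormedAddCommGroup E] {f : Cylinder → E}
    (hf : LocallyIntegrable f volume) :
    ∀ᵐ t : ℝ, Integrable fun y : UnitAddCircle => f (t, y) := by
  have h1 : ∀ m, ∀ᵐ t ∂(volume : Measure ℝ).restrict (compactCovering ℝ m),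
      Integrable fun y : UnitAddCircle => f (t, y) := by
    intro m
    have h2 : IntegrableOn f _ ((volume : Measure ℝ).prod (volume : Measure UnitAddCircle)) :=
      hf.integrableOn_isCompact
      ((isCompact_compactCovering ℝ m).prod (isCompact_univ (X := UnitAddCircle)))
    rw [IntegrableOn, ← Measure.prod_restrict, Measure.restrict_univ] at h2
    exact h2.prod_right_ae
  rw [← ae_restrict_iUnion_iff, iUnion_compactCovering, Measure.restrict_univ] at h1
  exact h1

/-- Rotations act continuously on square integrable functions. -/
lemma continuous_integral_mul_rotate {φ ψ : Cylinder → ℝ} (hφ : MemLp φ 2 volume)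
    (hψ : MemLp ψ 2 volume) :
    Continuous fun r : ℝ => ∫ x : Cylinder, φ x * ψ (x.1, x.2 + (r : UnitAddCircle)) := by
  let T : C(ℝ, C(Cylinder, Cylinder)) :=
    (ContinuousMap.mk (fun p : ℝ × Cylinder =>
      ((p.2.1, p.2.2 + (p.1 : UnitAddCircle)) : Cylinder))
      (by
        have : Continuous fun r : ℝ => (r : UnitAddCircle) := AddCircle.continuous_mk' 1
        fun_prop)).curry
  have hT : ∀ r, MeasurePreserving (T r) volume volume := fun r =>
    measurePreserving_rotate (r : UnitAddCircle)
  have hc : Continuous fun r : ℝ => Lp.compMeasurePreserving (T r) (hT r) (hψ.toLp ψ) :=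
    Continuous.compMeasurePreservingLp continuous_const T.continuous hT (by simp)
  have h1 : Continuous fun r : ℝ => inner ℝ (hφ.toLp φ)
      (Lp.compMeasurePreserving (T r) (hT r) (hψ.toLp ψ)) := by fun_prop
  convert h1 using 2 with r
  rw [L2.inner_def]
  refine integral_congr_ae ?_
  filter_upwards [hφ.coeFn_toLp, Lp.coeFn_compMeasurePreserving (hψ.toLp ψ) (hT r),
    (hT r).quasiMeasurePreserving.ae hψ.coeFn_toLp] with x h1 h2 h3
  rw [h1, h2, Function.comp_apply, h3]
  simp only [RCLike.inner_apply, conj_trivial]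
  exact mul_comm _ _

/-- The continuity of the correlation of `|φ|` and `|ψ|` gives the integrability that Fubini's theorem
requires in the angle of rotation. -/
lemma integrable_mul_rotate {φ ψ : Cylinder → ℝ} (hφ : MemLp φ 2 volume)
    (hψ : MemLp ψ 2 volume) (γ : ℝ → UnitAddCircle) (hγ : Continuous γ)
    (hc : Continuous fun r : ℝ => ∫ x : Cylinder, |φ x| * |ψ (x.1, x.2 + γ r)|) (a b : ℝ) :
    Integrable (fun p : ℝ × Cylinder => φ p.2 * ψ (p.2.1, p.2.2 + γ p.1))
      ((volume.restrict (Set.uIoc a b)).prod volume) := by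
  have hγ' : Continuous fun r : ℝ => ((0, γ r) : Cylinder) := by fun_prop
  have hm : AEStronglyMeasurable (fun p : ℝ × Cylinder => φ p.2 * ψ (p.2.1, p.2.2 + γ p.1))
      ((volume.restrict (Set.uIoc a b)).prod volume) := by
    refine hφ.1.comp_snd.mul ?_
    have := hψ.1.comp_snd (μ := volume.restrict (Set.uIoc a b)) |>.comp_measurePreserving
      (measurePreserving_shear (μ := (volume : Measure Cylinder))
        (volume.restrict (Set.uIoc a b)) hγ')
    simpa [Function.comp_def, Prod.add_def] using this
  refine (integrable_prod_iff hm).2 ⟨.of_forall fun r => ?_, ?_⟩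
  · exact hφ.integrable_mul (hψ.comp_measurePreserving (measurePreserving_rotate (γ r)))
  · simp only [norm_mul, Real.norm_eq_abs]
    exact intervalIntegrable_iff.1 (hc.intervalIntegrable a b)

lemma locallyIntegrable_norm {X : Type*} [TopologicalSpace X] [MeasurableSpace X] {μ : Measure X}
    {f : X → ℝ} (hf : LocallyIntegrable f μ) : LocallyIntegrable (fun x => ‖f x‖) μ := fun x => by
  obtain ⟨U, hU, hfU⟩ := hf x
  exact ⟨U, hU, Integrable.norm hfU⟩

/-! ### Slices near the ends -/

section Slices

variable {f f₁ f₂ g g₁ g₂ : Cylinder → ℝ}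

/-- If the vertical derivative has small mean square on a slice, then the function is uniformly
close to its mean on that slice. -/
lemma HasACGradient.ae_abs_sub_average_lt (F : HasACGradient f f₁ f₂)
    (hf : LocallyIntegrable f volume) (hf₂ : MemLp f₂ 2 volume) {ε : ℝ} (hε : 0 < ε) :
    ∀ᵐ t : ℝ, (∫ y, f₂ (t, y) ^ 2) < ε ^ 2 → ∀ᵐ y, |f (t, y) - ∫ z, f (t, z)| < ε := by
  filter_upwards [F.snd, ae_integrable_circle hf,
    ae_integrable_circle hf₂.integrable_sq.locallyIntegrable] with t h1 h2 h3 h4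
  -- Young's inequality, with the weight for which the bound is `ε / 2 + ε / 2`
  have h5 : ∫ y, |f₂ (t, y)| ≤ ∫ y, (1 / (2 * ε)) * (f₂ (t, y) ^ 2) + ε / 2 := by
    refine integral_mono_of_nonneg (.of_forall fun y => abs_nonneg _)
      ((h3.const_mul _).add (integrable_const _)) (.of_forall fun y => ?_)
    have : 0 ≤ (|f₂ (t, y)| - ε) ^ 2 / (2 * ε) := by positivity
    have e : (1 / (2 * ε)) * (f₂ (t, y) ^ 2) + ε / 2 - |f₂ (t, y)|
        = (|f₂ (t, y)| - ε) ^ 2 / (2 * ε) := by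
      rw [← sq_abs (f₂ (t, y))]; field_simp; ring
    change |f₂ (t, y)| ≤ (1 / (2 * ε)) * (f₂ (t, y) ^ 2) + ε / 2
    linarith
  have h6 : ∫ y, ((1 / (2 * ε)) * (f₂ (t, y) ^ 2) + ε / 2) < ε := by
    rw [integral_add (h3.const_mul _) (integrable_const _), integral_const_mul]
    simp only [integral_const, measureReal_def, UnitAddCircle.measure_univ, ENNReal.toReal_one,
      smul_eq_mul, one_mul]
    have : (1 / (2 * ε)) * ∫ y, f₂ (t, y) ^ 2 < (1 / (2 * ε)) * ε ^ 2 := by gcongr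
    have e : (1 / (2 * ε)) * ε ^ 2 = ε / 2 := by field_simp
    linarith
  filter_upwards [HasACDeriv.abs_sub_integral_circle_le (q := fun y => f (t, y))
    (q' := fun y => f₂ (t, y)) h1 h2] with y hy
  exact hy.trans_lt (h5.trans_lt h6)

/-- Near either end there are many slices on which two functions with square integrable gradient
are uniformly close to the limits of their means. -/
lemma frequently_slice_close {l : Filter ℝ} (hl : ∀ S ∈ l, volume S = ⊤)
    (F : HasACGradient f f₁ f₂) (G : HasACGradient g g₁ g₂)
    (hf : LocallyIntegrable f volume) (hg : LocallyIntegrable g volume)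
    (hf₂ : MemLp f₂ 2 volume) (hg₂ : MemLp g₂ 2 volume) {A B : ℝ}
    (hA : Tendsto (fun t => ∫ y, f (t, y)) (l ⊓ ae volume) (𝓝 A))
    (hB : Tendsto (fun t => ∫ y, g (t, y)) (l ⊓ ae volume) (𝓝 B)) {ε : ℝ} (hε : 0 < ε) :
    ∃ᶠ t in l ⊓ ae volume, ∀ᵐ y, |f (t, y) - A| < ε ∧ |g (t, y) - B| < ε := by
  have hsum : Integrable (fun x : Cylinder => f₂ x ^ 2 + g₂ x ^ 2)
      ((volume : Measure ℝ).prod volume) := hf₂.integrable_sq.add hg₂.integrable_sq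
  have hε2 : 0 < ε / 2 := half_pos hε
  have h1 := frequently_lt_of_integrable hl hsum.integral_prod_left (pow_pos hε2 2)
  have h2 := Metric.tendsto_nhds.1 hA _ hε2
  have h3 := Metric.tendsto_nhds.1 hB _ hε2
  have h4 := mem_inf_of_right (f := l) (F.ae_abs_sub_average_lt hf hf₂ hε2)
  have h5 := mem_inf_of_right (f := l) (G.ae_abs_sub_average_lt hg hg₂ hε2)
  have h6 := mem_inf_of_right (f := l) (ae_integrable_circle hf₂.integrable_sq.locallyIntegrable)
  have h7 := mem_inf_of_right (f := l) (ae_integrable_circle hg₂.integrable_sq.locallyIntegrable)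
  refine (h1.and_eventually (h2.and (h3.and (inter_mem h4 (inter_mem h5 (inter_mem h6 h7)))))).mono ?_
  rintro t ⟨h1, h2, h3, h4, h5, h6, h7⟩
  simp only [Set.mem_ofPred_eq] at h4 h5 h6 h7
  rw [integral_add h6 h7] at h1
  have p1 : 0 ≤ ∫ y, f₂ (t, y) ^ 2 := integral_nonneg fun y => sq_nonneg _
  have p2 : 0 ≤ ∫ y, g₂ (t, y) ^ 2 := integral_nonneg fun y => sq_nonneg _
  filter_upwards [h4 (by linarith), h5 (by linarith)] with y h8 h9
  rw [Real.dist_eq] at h2 h3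
  rw [abs_lt] at h2 h3 h8 h9
  constructor <;> rw [abs_lt] <;> constructor <;>
    linarith [h2.1, h2.2, h3.1, h3.2, h8.1, h8.2, h9.1, h9.2]

lemma abs_integral_circle_sub_le {q : UnitAddCircle → ℝ} {c ε : ℝ}
    (hq : Integrable q) (h : ∀ᵐ y, |q y - c| ≤ ε) : |(∫ y, q y) - c| ≤ ε := by
  have h2 : (∫ y, q y) - c = ∫ y, (q y - c) := by
    rw [integral_sub hq (integrable_const _)]
    simp [measureReal_def]
  rw [h2, ← Real.norm_eq_abs]
  refine (norm_integral_le_of_norm_le_const (C := ε) (by simpa using h)).trans ?_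
  simp [measureReal_def]

end Slices

/-! ### The entropy identity -/

section Entropy

variable {f f₁ f₂ g g₁ g₂ : Cylinder → ℝ}

/-- The first component of the Jin–Kohn entropy. -/
noncomputable def entropy (x y : ℝ) : ℝ := y * (1 - x ^ 2 - y ^ 2 / 3)

lemma continuous_entropy : Continuous fun p : ℝ × ℝ => entropy p.1 p.2 := by
  unfold entropy; fun_prop

/-- For divergence-free maps the entropy production integrates to the difference of the entropies
of the end states. The entropy is the vector field `(Φ(u₁, u₂), Φ(u₂, u₁))` with `Φ = entropy`; its
second component drops out on integration over the circle. -/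
theorem integral_entropy_production (F : HasACGradient f f₁ f₂) (G : HasACGradient g g₁ g₂)
    (hf : LocSq f) (hg : LocSq g)
    (hf₁ : MemLp f₁ 2 volume) (hf₂ : MemLp f₂ 2 volume)
    (hg₁ : MemLp g₁ 2 volume) (hg₂ : MemLp g₂ 2 volume)
    (hW : MemLp (fun x => 1 - f x ^ 2 - g x ^ 2) 2 volume)
    (hdiv : ∀ᵐ x, f₁ x + g₂ x = 0) {A A' B B' : ℝ}
    (hA : Tendsto (fun t => ∫ y, f (t, y)) (atBot ⊓ ae volume) (𝓝 A))
    (hA' : Tendsto (fun t => ∫ y, f (t, y)) (atTop ⊓ ae volume) (𝓝 A'))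
    (hB : Tendsto (fun t => ∫ y, g (t, y)) (atBot ⊓ ae volume) (𝓝 B))
    (hB' : Tendsto (fun t => ∫ y, g (t, y)) (atTop ⊓ ae volume) (𝓝 B')) :
    ∫ x, (1 - f x ^ 2 - g x ^ 2) * (g₁ x + f₂ x) = entropy A' B' - entropy A B := by
  set ρ : Cylinder → ℝ := fun x => 1 - f x ^ 2 - g x ^ 2 with hρ
  have hρ' : LocSq ρ := .of_memLp hW
  have hf₁' : LocSq f₁ := .of_memLp hf₁
  have hf₂' : LocSq f₂ := .of_memLp hf₂
  have hg₁' : LocSq g₁ := .of_memLp hg₁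
  have hq : Integrable (fun x => ρ x * (g₁ x + f₂ x)) volume := hW.integrable_mul (hg₁.add hf₂)
  -- `|2 f g| ≤ f² + g² = 1 - ρ`, and `ρ` is square integrable
  have hcross : LocallyIntegrable (fun x => 2 * f x * g x * f₁ x) volume := by
    refine ((locallyIntegrable_norm hf₁'.locallyIntegrable).add
      (locallyIntegrable_norm (hf₁'.mul hρ'))).mono
      (((hf.1.const_mul 2).mul hg.1).mul hf₁.1) (.of_forall fun x => ?_)
    simp only [Pi.add_apply, Real.norm_eq_abs]
    rw [abs_mul, abs_mul (f₁ x), abs_of_nonneg (by positivity :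
      0 ≤ |f₁ x| + |f₁ x| * |ρ x|)]
    have h1 : |2 * f x * g x| ≤ 1 + |ρ x| := by
      have : ρ x = 1 - f x ^ 2 - g x ^ 2 := rfl
      rw [abs_le]
      constructor <;> nlinarith [neg_abs_le (ρ x), sq_nonneg (f x - g x), sq_nonneg (f x + g x)]
    nlinarith [abs_nonneg (f₁ x)]
  have hgρ := hg.mul hρ'
  have hE : LocallyIntegrable (fun x => entropy (f x) (g x)) volume := by
    refine (((locallyIntegrable_norm hg.locallyIntegrable).add
      (locallyIntegrable_norm hgρ)).smul (2 : ℝ)).mono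
      (continuous_entropy.comp_aestronglyMeasurable (hf.1.prodMk hg.1)) (.of_forall fun x => ?_)
    simp only [Pi.add_apply, Pi.smul_apply, smul_eq_mul, Real.norm_eq_abs, entropy]
    rw [abs_mul, abs_mul (g x), abs_of_nonneg (by positivity :
      0 ≤ 2 * (|g x| + |g x| * |ρ x|))]
    have h1 : |1 - f x ^ 2 - g x ^ 2 / 3| ≤ 1 + 2 * |ρ x| := by
      have : ρ x = 1 - f x ^ 2 - g x ^ 2 := rfl
      rw [abs_le]
      constructor <;> nlinarith [neg_abs_le (ρ x), abs_nonneg (ρ x), le_abs_self (ρ x),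
        sq_nonneg (f x), sq_nonneg (g x)]
    nlinarith [abs_nonneg (g x)]
  have hk' : LocallyIntegrable (fun x => g₁ x * ρ x - 2 * f x * g x * f₁ x) volume :=
    (hg₁'.mul hρ').sub hcross
  have hm' : LocallyIntegrable (fun x => f₂ x * ρ x + 2 * f x * g x * f₁ x) volume :=
    (hf₂'.mul hρ').add hcross
  have hP : HasACDeriv (fun t => ∫ y, entropy (f (t, y)) (g (t, y)))
      (fun t => ∫ y, (g₁ (t, y) * ρ (t, y) - 2 * f (t, y) * g (t, y) * f₁ (t, y))) := by
    refine hasACDeriv_integral (F := fun x => entropy (f x) (g x))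
      (F' := fun x => g₁ x * ρ x - 2 * f x * g x * f₁ x) hE hk' ?_
    filter_upwards [F.fst, G.fst] with y h1 h2
    refine (h2.mul (((HasACDeriv.const 1).sub (h1.mul h1)).sub
      ((h2.mul h2).const_mul (1 / 3)))).congr (.of_forall fun t => ?_) (.of_forall fun t => ?_)
    · simp only [entropy]; ring
    · simp only [hρ]; ring
  -- the vertical component of the entropy integrates to zero over the circle, and `g₂ = -f₁`
  have hslice : ∀ᵐ t : ℝ,
      ∫ y, (g₁ (t, y) * ρ (t, y) - 2 * f (t, y) * g (t, y) * f₁ (t, y)) =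
        ∫ y, ρ (t, y) * (g₁ (t, y) + f₂ (t, y)) := by
    filter_upwards [F.snd, G.snd, ae_integrable_circle hk', ae_integrable_circle hm',
      Measure.ae_ae_of_ae_prod (μ := (volume : Measure ℝ)) hdiv] with t h1 h2 h3 h4 h5
    have h6 := HasACDeriv.integral_circle_eq_zero
      (q := fun y => f (t, y) * (1 - g (t, y) ^ 2 - f (t, y) ^ 2 / 3))
      (q' := fun y => f₂ (t, y) * ρ (t, y) - 2 * f (t, y) * g (t, y) * g₂ (t, y))
      ((h1.mul (((HasACDeriv.const 1).sub (h2.mul h2)).sub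
        ((h1.mul h1).const_mul (1 / 3)))).congr
        (.of_forall fun r => by simp only; ring) (.of_forall fun r => by simp only [hρ]; ring))
    have h7 : ∫ y, (f₂ (t, y) * ρ (t, y) + 2 * f (t, y) * g (t, y) * f₁ (t, y)) = 0 := by
      rw [← h6]
      refine integral_congr_ae ?_
      filter_upwards [h5] with y hy
      rw [eq_neg_of_add_eq_zero_left hy]; ring
    rw [← add_zero (∫ y, (g₁ (t, y) * ρ (t, y) - 2 * f (t, y) * g (t, y) * f₁ (t, y))), ← h7,
      ← integral_add h3 h4]
    refine integral_congr_ae (.of_forall fun y => ?_)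
    simp only; ring
  have hq' : Integrable (fun x => ρ x * (g₁ x + f₂ x))
      ((volume : Measure ℝ).prod (volume : Measure UnitAddCircle)) := hq
  have hlim : ∀ {l : Filter ℝ} (hl : ∀ S ∈ l, volume S = ⊤) {a b : ℝ},
      Tendsto (fun t => ∫ y, f (t, y)) (l ⊓ ae volume) (𝓝 a) →
      Tendsto (fun t => ∫ y, g (t, y)) (l ⊓ ae volume) (𝓝 b) → ∀ ε > 0,
      ∃ᶠ t in l ⊓ ae volume, |(∫ y, entropy (f (t, y)) (g (t, y))) - entropy a b| < ε := by
    intro l hl a b ha hb ε hε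
    obtain ⟨δ, hδ, hδ'⟩ := Metric.continuous_iff.1 continuous_entropy (a, b) (ε / 2) (half_pos hε)
    refine ((frequently_slice_close hl F G hf.locallyIntegrable hg.locallyIntegrable hf₂ hg₂ ha hb
      hδ).and_eventually (mem_inf_of_right (ae_integrable_circle hE))).mono ?_
    rintro t ⟨h1, h2⟩
    refine (abs_integral_circle_sub_le h2 (ε := ε / 2) ?_).trans_lt (half_lt_self hε)
    filter_upwards [h1] with y hy
    have := hδ' (f (t, y), g (t, y)) (by
      rw [Prod.dist_eq, max_lt_iff, Real.dist_eq, Real.dist_eq]; exact hy)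
    rw [Real.dist_eq] at this
    exact this.le
  have hfin := (hP.congr .rfl hslice).integral_eq_sub hq'.integral_prod_left
    (hlim volume_eq_top_of_mem_atBot hA hB) (hlim volume_eq_top_of_mem_atTop hA' hB')
  rw [← hfin]
  exact integral_prod _ hq'

end Entropy

/-! ### The Jacobian integrates to zero -/

section Jacobian

variable {f f₁ f₂ g g₁ g₂ : Cylinder → ℝ}

lemma memLp_abs {X : Type*} [MeasurableSpace X] {μ : Measure X} {φ : X → ℝ} (h : MemLp φ 2 μ) :
    MemLp (fun x => |φ x|) 2 μ := h.norm

lemma continuous_neg_rotate {φ ψ : Cylinder → ℝ} (hφ : MemLp φ 2 volume)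
    (hψ : MemLp ψ 2 volume) :
    Continuous fun r : ℝ => ∫ x : Cylinder, φ x * ψ (x.1, x.2 + -(r : UnitAddCircle)) := by
  have := (continuous_integral_mul_rotate hφ hψ).comp continuous_neg
  simpa [Function.comp_def, AddCircle.coe_neg] using this

/-- The Jacobian identity with vertical derivatives replaced by differences. On each slice, the
rotation invariance of the integral turns the `x₁`-derivative of `f (x) (g (x + h) - g (x))` into the
finite-difference Jacobian. -/
lemma integral_difference_jacobian (F : HasACGradient f f₁ f₂) (G : HasACGradient g g₁ g₂)
    (hf : LocSq f) (hg : LocSq g)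
    (hf₁ : MemLp f₁ 2 volume) (hf₂ : MemLp f₂ 2 volume)
    (hg₁ : MemLp g₁ 2 volume) (hg₂ : MemLp g₂ 2 volume) {A A' B B' : ℝ}
    (hA : Tendsto (fun t => ∫ y, f (t, y)) (atBot ⊓ ae volume) (𝓝 A))
    (hA' : Tendsto (fun t => ∫ y, f (t, y)) (atTop ⊓ ae volume) (𝓝 A'))
    (hB : Tendsto (fun t => ∫ y, g (t, y)) (atBot ⊓ ae volume) (𝓝 B))
    (hB' : Tendsto (fun t => ∫ y, g (t, y)) (atTop ⊓ ae volume) (𝓝 B')) (h : UnitAddCircle)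
    (hR : Integrable (fun x : Cylinder => f₁ x * (g (x.1, x.2 + h) - g x) +
      (f (x.1, x.2 + -h) - f x) * g₁ x)) :
    ∫ x : Cylinder, (f₁ x * (g (x.1, x.2 + h) - g x) + (f (x.1, x.2 + -h) - f x) * g₁ x) = 0 := by
  have hf₁' : LocSq f₁ := .of_memLp hf₁
  have hg₁' : LocSq g₁ := .of_memLp hg₁
  have hk : LocallyIntegrable (fun x : Cylinder => f x * (g (x.1, x.2 + h) - g x)) volume :=
    hf.mul ((hg.rotate h).sub hg)
  have hk' : LocallyIntegrable (fun x : Cylinder => f₁ x * (g (x.1, x.2 + h) - g x) +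
      f x * (g₁ (x.1, x.2 + h) - g₁ x)) volume :=
    (hf₁'.mul ((hg.rotate h).sub hg)).add (hf.mul ((hg₁'.rotate h).sub hg₁'))
  have hP : HasACDeriv (fun t => ∫ y, f (t, y) * (g (t, y + h) - g (t, y)))
      (fun t => ∫ y, (f₁ (t, y) * (g (t, y + h) - g (t, y)) +
        f (t, y) * (g₁ (t, y + h) - g₁ (t, y)))) := by
    refine hasACDeriv_integral (F := fun x : Cylinder => f x * (g (x.1, x.2 + h) - g x))
      (F' := fun x : Cylinder => f₁ x * (g (x.1, x.2 + h) - g x) +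
        f x * (g₁ (x.1, x.2 + h) - g₁ x)) hk hk' ?_
    filter_upwards [F.fst, G.fst, (quasiMeasurePreserving_add_right volume h).ae G.fst]
      with y h1 h2 h3
    exact h1.mul (h3.sub h2)
  -- rotation by `-h` moves the increment from `g₁` to `f`
  have hslice : ∀ᵐ t : ℝ, ∫ y, (f₁ (t, y) * (g (t, y + h) - g (t, y)) +
        f (t, y) * (g₁ (t, y + h) - g₁ (t, y))) =
      ∫ y, (f₁ (t, y) * (g (t, y + h) - g (t, y)) + (f (t, y + -h) - f (t, y)) * g₁ (t, y)) := by
    have hR' : Integrable (fun x : Cylinder => f₁ x * (g (x.1, x.2 + h) - g x) +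
      (f (x.1, x.2 + -h) - f x) * g₁ x) ((volume : Measure ℝ).prod volume) := hR
    filter_upwards [hR'.prod_right_ae,
      ae_integrable_circle ((hf.rotate (-h)).mul hg₁')] with t h1 h2
    have h3 : Integrable fun y => f (t, y) * g₁ (t, y + h) := by
      have := h2.comp_add_right h
      simpa using this
    have h4 : ∫ y, f (t, y) * g₁ (t, y + h) = ∫ y, f (t, y + -h) * g₁ (t, y) := by
      rw [← integral_add_right_eq_self (fun y => f (t, y + -h) * g₁ (t, y)) h]
      simp
    have h5 : ∫ y, (f (t, y) * g₁ (t, y + h) - f (t, y + -h) * g₁ (t, y)) = 0 := by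
      rw [integral_sub h3 h2, h4, sub_self]
    rw [← add_zero (∫ y, (f₁ (t, y) * (g (t, y + h) - g (t, y)) +
      (f (t, y + -h) - f (t, y)) * g₁ (t, y))), ← h5]
    have h6 := integral_add h1 (h3.sub h2)
    simp only [Pi.sub_apply] at h6
    rw [← h6]
    refine integral_congr_ae (.of_forall fun y => ?_)
    simp only; ring
  have hlim : ∀ {l : Filter ℝ} (hl : ∀ S ∈ l, volume S = ⊤) {a b : ℝ},
      Tendsto (fun t => ∫ y, f (t, y)) (l ⊓ ae volume) (𝓝 a) →
      Tendsto (fun t => ∫ y, g (t, y)) (l ⊓ ae volume) (𝓝 b) → ∀ ε > 0,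
      ∃ᶠ t in l ⊓ ae volume, |(∫ y, f (t, y) * (g (t, y + h) - g (t, y))) - 0| < ε := by
    intro l hl a b ha hb ε hε
    obtain ⟨δ, hδ, hδ1, hδ'⟩ : ∃ δ > 0, δ ≤ 1 ∧ (|a| + 1) * (2 * δ) ≤ ε / 2 := by
      refine ⟨min 1 (ε / (4 * (|a| + 1))), lt_min one_pos (by positivity), min_le_left _ _, ?_⟩
      calc (|a| + 1) * (2 * min 1 (ε / (4 * (|a| + 1))))
          ≤ (|a| + 1) * (2 * (ε / (4 * (|a| + 1)))) := by gcongr; exact min_le_right _ _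
        _ = ε / 2 := by field_simp; ring
    refine ((frequently_slice_close hl F G hf.locallyIntegrable hg.locallyIntegrable hf₂ hg₂ ha hb
      hδ).and_eventually (mem_inf_of_right (ae_integrable_circle hk))).mono ?_
    rintro t ⟨h1, h2⟩
    refine (abs_integral_circle_sub_le h2 (ε := ε / 2) ?_).trans_lt (half_lt_self hε)
    filter_upwards [h1, (quasiMeasurePreserving_add_right volume h).ae h1] with y h3 h4
    rw [sub_zero, abs_mul]
    refine le_trans ?_ hδ'
    have h5 : |f (t, y)| ≤ |a| + 1 := by
      have := abs_sub_abs_le_abs_sub (f (t, y)) a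
      linarith [h3.1]
    have h6 : |g (t, y + h) - g (t, y)| ≤ 2 * δ := by
      have := abs_sub_le (g (t, y + h)) b (g (t, y))
      rw [abs_sub_comm b] at this
      linarith [h3.2, h4.2]
    gcongr
  have hR' : Integrable (fun x : Cylinder => f₁ x * (g (x.1, x.2 + h) - g x) +
      (f (x.1, x.2 + -h) - f x) * g₁ x) ((volume : Measure ℝ).prod volume) := hR
  have hfin := (hP.congr .rfl hslice).integral_eq_sub hR'.integral_prod_left
    (hlim volume_eq_top_of_mem_atBot hA hB) (hlim volume_eq_top_of_mem_atTop hA' hB')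
  rw [sub_zero] at hfin
  rw [← hfin]
  exact integral_prod _ hR'

/-- The Jacobian determinant of a map with square integrable gradient and limits of its means at
both ends integrates to zero. It is the value at zero of a continuous function of the angle of
rotation, all of whose integrals vanish by `integral_difference_jacobian`. -/
theorem integral_jacobian (F : HasACGradient f f₁ f₂) (G : HasACGradient g g₁ g₂)
    (hf : LocSq f) (hg : LocSq g)
    (hf₁ : MemLp f₁ 2 volume) (hf₂ : MemLp f₂ 2 volume)
    (hg₁ : MemLp g₁ 2 volume) (hg₂ : MemLp g₂ 2 volume) {A A' B B' : ℝ}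
    (hA : Tendsto (fun t => ∫ y, f (t, y)) (atBot ⊓ ae volume) (𝓝 A))
    (hA' : Tendsto (fun t => ∫ y, f (t, y)) (atTop ⊓ ae volume) (𝓝 A'))
    (hB : Tendsto (fun t => ∫ y, g (t, y)) (atBot ⊓ ae volume) (𝓝 B))
    (hB' : Tendsto (fun t => ∫ y, g (t, y)) (atTop ⊓ ae volume) (𝓝 B')) :
    ∫ x, (f₁ x * g₂ x - f₂ x * g₁ x) = 0 := by
  -- the correlation of the partial derivatives at distance `r`; the claim is that it vanishes at `0`
  set J : ℝ → ℝ := fun r => (∫ x : Cylinder, f₁ x * g₂ (x.1, x.2 + (r : UnitAddCircle))) -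
    ∫ x : Cylinder, g₁ x * f₂ (x.1, x.2 + -(r : UnitAddCircle)) with hJ
  have hJc : Continuous J :=
    (continuous_integral_mul_rotate hf₁ hg₂).sub (continuous_neg_rotate hg₁ hf₂)
  have hmk : Continuous fun r : ℝ => (r : UnitAddCircle) := AddCircle.continuous_mk' 1
  have hJint : ∀ h : ℝ, ∫ r in (0 : ℝ)..h, J r = 0 := by
    intro h
    have i1 := integrable_mul_rotate hf₁ hg₂ (fun r : ℝ => (r : UnitAddCircle)) hmk
      (continuous_integral_mul_rotate (memLp_abs hf₁) (memLp_abs hg₂)) 0 h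
    have i2 := integrable_mul_rotate hg₁ hf₂ (fun r : ℝ => -(r : UnitAddCircle)) hmk.neg
      (continuous_neg_rotate (memLp_abs hg₁) (memLp_abs hf₂)) 0 h
    have e1 : ∀ᵐ x : Cylinder, ∫ r in (0 : ℝ)..h, f₁ x * g₂ (x.1, x.2 + (r : UnitAddCircle)) =
        f₁ x * (g (x.1, x.2 + (h : UnitAddCircle)) - g x) := by
      filter_upwards [G.translate h] with x hx
      rw [hx, intervalIntegral.integral_const_mul]
    have e2 : ∀ᵐ x : Cylinder, ∫ r in (0 : ℝ)..h, g₁ x * f₂ (x.1, x.2 + -(r : UnitAddCircle)) =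
        -((f (x.1, x.2 + -(h : UnitAddCircle)) - f x) * g₁ x) := by
      filter_upwards [F.translate (-h)] with x hx
      rw [AddCircle.coe_neg] at hx
      have := intervalIntegral.integral_comp_neg (a := 0) (b := h)
        (fun r : ℝ => f₂ (x.1, x.2 + (r : UnitAddCircle)))
      simp only [AddCircle.coe_neg, neg_zero] at this
      rw [hx, intervalIntegral.integral_const_mul, this, intervalIntegral.integral_symm]
      ring
    have j1 := (integrable_intervalIntegral i1).congr e1
    have j2 := (integrable_intervalIntegral i2).congr e2
    have hR : Integrable (fun x : Cylinder => f₁ x * (g (x.1, x.2 + (h : UnitAddCircle)) - g x) +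
        (f (x.1, x.2 + -(h : UnitAddCircle)) - f x) * g₁ x) := by
      refine (j1.sub j2).congr (.of_forall fun x => ?_)
      simp
    have h0 := integral_difference_jacobian F G hf hg hf₁ hf₂ hg₁ hg₂ hA hA' hB hB' h hR
    rw [hJ]
    simp only
    rw [intervalIntegral.integral_sub (intervalIntegrable_integral i1)
        (intervalIntegrable_integral i2),
      intervalIntegral_integral_swap
        (f := fun (r : ℝ) (x : Cylinder) => f₁ x * g₂ (x.1, x.2 + (r : UnitAddCircle))) i1,
      intervalIntegral_integral_swap
        (f := fun (r : ℝ) (x : Cylinder) => g₁ x * f₂ (x.1, x.2 + -(r : UnitAddCircle))) i2,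
      integral_congr_ae e1, integral_congr_ae e2, ← integral_sub j1 j2, ← h0]
    refine integral_congr_ae (.of_forall fun x => ?_)
    simp
  have hJ0 : J 0 = 0 := by
    have h1 := intervalIntegral.integral_hasDerivAt_right (hJc.intervalIntegrable 0 0)
      (hJc.stronglyMeasurableAtFilter _ _) hJc.continuousAt
    simp_rw [hJint] at h1
    exact h1.unique (hasDerivAt_const 0 0)
  rw [hJ] at hJ0
  simp only [AddCircle.coe_zero, neg_zero, add_zero, Prod.mk.eta] at hJ0
  have h2 := integral_sub (hf₁.integrable_mul hg₂) (hg₁.integrable_mul hf₂)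
  simp only [Pi.mul_apply] at h2
  rw [← hJ0, ← h2]
  refine integral_congr_ae (.of_forall fun x => ?_)
  simp only; ring

end Jacobian

/-! ### The one-dimensional profile -/

/-- The function `b tanh (|b| t)`, written with a single exponential. The absolute value makes it
tend to `b` at `+∞` for either sign of `b`. -/
noncomputable def profile (b t : ℝ) : ℝ := b * (1 - 2 / (Real.exp (2 * |b| * t) + 1))

section Profile

variable {b s : ℝ}

lemma profile_of_zero (t : ℝ) : profile 0 t = 0 := by simp [profile]

lemma contDiff_profile {n : WithTop ℕ∞} : ContDiff ℝ n (profile b) := by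
  unfold profile
  refine contDiff_const.mul (contDiff_const.sub (contDiff_const.div ?_ fun t => by positivity))
  fun_prop

lemma profile_zero : profile b 0 = 0 := by
  simp [profile]; norm_num

/-- The number `s` is the sign of `b`. For `b = 0` it is arbitrary, and the profile vanishes. -/
lemma hasDerivAt_profile (hs : s ^ 2 = 1) (hsb : s * b = |b|) (t : ℝ) :
    HasDerivAt (profile b) (s * (b ^ 2 - profile b t ^ 2)) t := by
  have h1 : HasDerivAt (fun t => Real.exp (2 * |b| * t) + 1)
      (Real.exp (2 * |b| * t) * (2 * |b|)) t := by
    simpa using (((hasDerivAt_id t).const_mul (2 * |b|)).exp).add_const 1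
  have hpos : Real.exp (2 * |b| * t) + 1 ≠ 0 := by positivity
  have h2 := (((hasDerivAt_const t (2 : ℝ)).div h1 hpos).const_sub 1).const_mul b
  unfold profile
  convert! h2 using 1
  have hb : b = s * |b| := by rw [← hsb, ← mul_assoc, ← sq, hs, one_mul]
  set E := Real.exp (2 * |b| * t)
  field_simp
  rw [show b ^ 2 = b * (s * |b|) by rw [← hb, sq]]
  linear_combination (4 * E * b * |b|) * hs

lemma tendsto_profile_atTop : Tendsto (profile b) atTop (𝓝 b) := by
  rcases eq_or_ne b 0 with rfl | hb
  · simpa using tendsto_const_nhds.congr fun t => (profile_of_zero t).symm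
  have hb' : 0 < 2 * |b| := by positivity
  have h1 : Tendsto (fun t => Real.exp (2 * |b| * t) + 1) atTop atTop :=
    tendsto_atTop_add_const_right _ _ (Real.tendsto_exp_atTop.comp (tendsto_id.const_mul_atTop hb'))
  have h2 := ((h1.const_div_atTop 2).const_sub 1).const_mul b
  simpa [profile, funext_iff, Function.comp_def] using! h2

lemma tendsto_profile_atBot : Tendsto (profile b) atBot (𝓝 (-b)) := by
  rcases eq_or_ne b 0 with rfl | hb
  · simpa using tendsto_const_nhds.congr fun t => (profile_of_zero t).symm
  have hb' : 0 < 2 * |b| := by positivity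
  have h1 : Tendsto (fun t => Real.exp (2 * |b| * t) + 1) atBot (𝓝 (0 + 1)) :=
    (Real.tendsto_exp_atBot.comp (tendsto_id.const_mul_atBot hb')).add_const 1
  have h2 := ((tendsto_const_nhds (x := (2 : ℝ))).div h1 (by norm_num)).const_sub 1 |>.const_mul b
  convert! h2 using 2
  norm_num

/-- The only solutions of `v' = ±(b² - v²)` joining `-b` to `b` are the translates of the
profile. -/
lemma exists_eq_profile (hs : s ^ 2 = 1) (hsb : s * b = |b|) {v : ℝ → ℝ}
    (hv : ∀ t, HasDerivAt v (s * (b ^ 2 - v t ^ 2)) t)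
    (hbot : Tendsto v atBot (𝓝 (-b))) (htop : Tendsto v atTop (𝓝 b)) :
    ∃ τ, ∀ t, v t = profile b (t + τ) := by
  have hvc : Continuous v := continuous_iff_continuousAt.2 fun t => (hv t).continuousAt
  rcases eq_or_ne b 0 with rfl | hb
  · -- here `s v` is antitone with limit `0` at both ends
    refine ⟨0, fun t => ?_⟩
    have hd : ∀ t, HasDerivAt (fun t => s * v t) (-(v t ^ 2)) t := fun t => by
      convert! (hv t).const_mul s using 1
      linear_combination (v t ^ 2) * hs
    have ha : Antitone fun t => s * v t :=
      antitone_of_hasDerivAt_nonpos hd fun t => by simp [sq_nonneg]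
    have l1 : Tendsto (fun t => s * v t) atBot (𝓝 0) := by simpa using hbot.const_mul s
    have l2 : Tendsto (fun t => s * v t) atTop (𝓝 0) := by simpa using htop.const_mul s
    have h0 : s * v t = 0 := le_antisymm (ha.ge_of_tendsto l1 t) (ha.le_of_tendsto l2 t)
    have : s ≠ 0 := by rintro rfl; norm_num at hs
    simpa [profile, this] using h0
  · have hb' : 0 < |b| := abs_pos.2 hb
    obtain ⟨t₀, ht₀⟩ : ∃ t₀, s * v t₀ = 0 := by
      have l1 : Tendsto (fun t => s * v t) atBot (𝓝 (-|b|)) := by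
        simpa [hsb] using hbot.const_mul s
      have l2 : Tendsto (fun t => s * v t) atTop (𝓝 |b|) := by simpa [hsb] using htop.const_mul s
      obtain ⟨t₁, h₁⟩ := (l1.eventually_lt_const (neg_lt_zero.2 hb')).exists
      obtain ⟨t₂, h₂⟩ := (l2.eventually_const_lt hb').exists
      exact mem_range_of_exists_le_of_exists_ge (continuous_const.mul hvc) ⟨t₁, h₁.le⟩ ⟨t₂, h₂.le⟩
    have hs0 : s ≠ 0 := by rintro rfl; norm_num at hs
    replace ht₀ : v t₀ = 0 := by simpa [hs0] using ht₀
    -- the difference of two solutions solves a linear equation, with an explicit integrating factor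
    set w : ℝ → ℝ := fun t => profile b (t + -t₀) with hw
    have hwd : ∀ t, HasDerivAt w (s * (b ^ 2 - w t ^ 2)) t := fun t => by
      simpa using (hasDerivAt_profile hs hsb (t + -t₀)).comp_add_const t (-t₀)
    have hwc : Continuous w := continuous_iff_continuousAt.2 fun t => (hwd t).continuousAt
    have hP : ∀ t, HasDerivAt (fun t => ∫ r in t₀..t, s * (v r + w r)) (s * (v t + w t)) t :=
      fun t => by
        have hc : Continuous fun r => s * (v r + w r) := by fun_prop
        exact intervalIntegral.integral_hasDerivAt_right (hc.intervalIntegrable _ _)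
          (hc.stronglyMeasurableAtFilter _ _) hc.continuousAt
    set Z : ℝ → ℝ := fun t => (v t - w t) * Real.exp (∫ r in t₀..t, s * (v r + w r)) with hZ
    have hZd : ∀ t, HasDerivAt Z 0 t := fun t => by
      convert! ((hv t).sub (hwd t)).mul (hP t).exp using 1
      simp only [Pi.sub_apply]
      ring
    refine ⟨-t₀, fun t => ?_⟩
    have h0 : Z t = Z t₀ :=
      is_const_of_deriv_eq_zero (fun t => (hZd t).differentiableAt) (fun t => (hZd t).deriv) t t₀
    have h1 : w t₀ = 0 := by simp [hw, profile_zero]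
    simp only [hZ, ht₀, h1, sub_self, zero_mul, mul_eq_zero, Real.exp_ne_zero, or_false] at h0
    exact sub_eq_zero.1 h0

/-- If `v` and its derivative both converge at `+∞`, the derivative converges to `0`. -/
lemma eq_zero_of_tendsto_deriv {v k : ℝ → ℝ} {L B : ℝ} (hv : ∀ t, HasDerivAt v (k t) t)
    (hk : Tendsto k atTop (𝓝 L)) (hB : Tendsto v atTop (𝓝 B)) : L = 0 := by
  have h1 : ∀ t : ℝ, ∃ ξ, t < ξ ∧ k ξ = v (t + 1) - v t := fun t => by
    obtain ⟨ξ, hξ, h⟩ := exists_hasDerivAt_eq_slope v k (lt_add_one t)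
      (fun x _ => (hv x).continuousAt.continuousWithinAt) (fun x _ => hv x)
    exact ⟨ξ, hξ.1, by simpa using h⟩
  choose ξ hξ hξ' using h1
  have h2 : Tendsto ξ atTop atTop := tendsto_atTop_mono (fun t => (hξ t).le) tendsto_id
  have h3 := hk.comp h2
  have h4 : Tendsto (fun t => v (t + 1) - v t) atTop (𝓝 (B - B)) :=
    (hB.comp (tendsto_atTop_add_const_right _ _ tendsto_id)).sub hB
  rw [sub_self] at h4
  exact tendsto_nhds_unique (h3.congr hξ') h4

/-- A primitive of the integrand `v'²` is `s (b² v - v³/3)`. -/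
lemma hasIntegral_profile (hs : s ^ 2 = 1) (hsb : s * b = |b|) :
    Integrable (fun t => (b ^ 2 - profile b t ^ 2) ^ 2) ∧
      ∫ t, (b ^ 2 - profile b t ^ 2) ^ 2 = 4 / 3 * |b| ^ 3 := by
  set H : ℝ → ℝ := fun t => s * (b ^ 2 * profile b t - profile b t ^ 3 / 3) with hH
  have hc : Continuous (profile b) := (contDiff_profile (n := 0)).continuous
  have hd : ∀ t, HasDerivAt H ((b ^ 2 - profile b t ^ 2) ^ 2) t := fun t => by
    have h := hasDerivAt_profile hs hsb t
    convert! ((h.const_mul (b ^ 2)).sub ((h.pow 3).div_const 3)).const_mul s using 1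
    norm_num
    linear_combination (-(b ^ 2 - profile b t ^ 2) ^ 2) * hs
  have hb3 : s * b ^ 3 = |b| ^ 3 := by
    rw [show |b| ^ 3 = |b| ^ 2 * |b| by ring, sq_abs, ← hsb]; ring
  have htop : Tendsto H atTop (𝓝 (2 / 3 * |b| ^ 3)) := by
    have := (((tendsto_profile_atTop (b := b)).const_mul (b ^ 2)).sub
      (((tendsto_profile_atTop (b := b)).pow 3).div_const 3)).const_mul s
    convert this using 2
    linear_combination (-2 / 3 : ℝ) * hb3
  have hbot : Tendsto H atBot (𝓝 (-(2 / 3 * |b| ^ 3))) := by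
    have := (((tendsto_profile_atBot (b := b)).const_mul (b ^ 2)).sub
      (((tendsto_profile_atBot (b := b)).pow 3).div_const 3)).const_mul s
    convert this using 2
    linear_combination (2 / 3 : ℝ) * hb3
  have hi : Integrable (fun t => (b ^ 2 - profile b t ^ 2) ^ 2) := by
    have hcont : Continuous fun t => (b ^ 2 - profile b t ^ 2) ^ 2 := by fun_prop
    refine (aecover_Ioc (μ := volume) (tendsto_neg_atTop_atBot (G := ℝ))
      tendsto_id).integrable_of_integral_tendsto_of_nonneg_ae
      (2 / 3 * |b| ^ 3 - -(2 / 3 * |b| ^ 3)) (fun t => hcont.integrableOn_Ioc)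
      (.of_forall fun t => sq_nonneg _) ?_
    have : Tendsto (fun t => H t - H (-t)) atTop (𝓝 (2 / 3 * |b| ^ 3 - -(2 / 3 * |b| ^ 3))) :=
      htop.sub (hbot.comp tendsto_neg_atTop_atBot)
    refine this.congr' ?_
    filter_upwards [eventually_ge_atTop 0] with t ht
    rw [id, ← intervalIntegral.integral_of_le (by linarith),
      intervalIntegral.integral_eq_sub_of_hasDerivAt (fun t _ => hd t) (hcont.intervalIntegrable _ _)]
  refine ⟨hi, ?_⟩
  rw [integral_of_hasDerivAt_of_tendsto hd hi hbot htop]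
  ring

end Profile

/-! ### Weak derivatives of one-dimensional maps -/

section Unique

variable {V : Type*} [NormedAddCommGroup V] [NormedSpace ℝ V] [FiniteDimensional ℝ V]
  [MeasureSpace V] [BorelSpace V] {e : V} {f g g' : V → Plane}

lemma IsWeakDeriv.unique (h : IsWeakDeriv e f g) (h' : IsWeakDeriv e f g') : g =ᵐ[volume] g' :=
  ae_eq_of_integral_contDiff_smul_eq h.2.1 h'.2.1 fun φ hφ hs =>
    neg_injective ((h.2.2 φ hφ hs).symm.trans (h'.2.2 φ hφ hs))

end Unique

lemma weakDeriv_spec {γ : ℝ → Plane} (h : ∃ v, IsWeakDeriv (1 : ℝ) γ v) :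
    IsWeakDeriv (1 : ℝ) γ (weakDeriv γ) := by
  rw [weakDeriv, dif_pos h]; exact Classical.choose_spec h

lemma weakGradient_spec {u : Cylinder → Plane} (h : ∃ D, IsWeakGradient u D) :
    IsWeakGradient u (weakGradient u) := by
  rw [weakGradient, dif_pos h]; exact Classical.choose_spec h

lemma weakDeriv_ae_eq {γ v : ℝ → Plane} (h : IsWeakDeriv (1 : ℝ) γ v) :
    weakDeriv γ =ᵐ[volume] v :=
  (weakDeriv_spec ⟨v, h⟩).unique h

lemma weakGradient_ae_eq {u : Cylinder → Plane} {D : Fin 2 → Cylinder → Plane}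
    (h : IsWeakGradient u D) (j : Fin 2) : weakGradient u j =ᵐ[volume] D j := by
  have hs := weakGradient_spec ⟨D, h⟩
  refine ae_cylinder_of_ae_plane (p := fun x => weakGradient u j x = D j x) ?_
  fin_cases j
  · exact hs.1.unique h.1
  · exact hs.2.unique h.2

lemma isWeakDeriv_of_hasDerivAt {γ γ' : ℝ → Plane} (h : ∀ t, HasDerivAt γ (γ' t) t)
    (hc : Continuous γ') : IsWeakDeriv (1 : ℝ) γ γ' := by
  have hγ : Continuous γ := continuous_iff_continuousAt.2 fun t => (h t).continuousAt
  refine ⟨hγ.locallyIntegrable, hc.locallyIntegrable, fun φ hφ hs => ?_⟩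
  have hdc : Continuous (deriv φ) := hφ.continuous_deriv (by simp)
  have := integral_bilinear_hasDerivAt_right_eq_neg_left_of_integrable
    (L := ContinuousLinearMap.lsmul ℝ ℝ) (u := φ) (v := γ) (u' := deriv φ) (v' := γ')
    (fun x _ => (hφ.differentiable (by simp) x).hasDerivAt) (fun x _ => h x)
    (hc.locallyIntegrable.integrable_smul_left_of_hasCompactSupport hφ.continuous hs)
    (hγ.locallyIntegrable.integrable_smul_left_of_hasCompactSupport hdc hs.deriv)
    (hγ.locallyIntegrable.integrable_smul_left_of_hasCompactSupport hφ.continuous hs)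
  simp only [ContinuousLinearMap.lsmul_apply] at this
  simp only [fderiv_apply_one_eq_deriv]
  rw [this, neg_neg]

section Extend

variable {γ γ' : ℝ → Plane}

lemma locallyIntegrable_comp_fst (h : LocallyIntegrable γ volume) :
    LocallyIntegrable (fun z : ℝ × ℝ => γ z.1) volume := by
  rintro ⟨t, y⟩
  obtain ⟨U, hU, hU'⟩ := h t
  refine ⟨U ×ˢ Set.Icc (y - 1) (y + 1),
    prod_mem_nhds hU (Icc_mem_nhds (by linarith) (by linarith)), ?_⟩
  rw [IntegrableOn, Measure.volume_eq_prod, ← Measure.prod_restrict]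
  exact Integrable.comp_fst hU' _

lemma isWeakDeriv_fst (h : IsWeakDeriv (1 : ℝ) γ γ') :
    IsWeakDeriv ((1, 0) : ℝ × ℝ) (fun z => γ z.1) (fun z => γ' z.1) := by
  obtain ⟨h1, h2, hw⟩ := h
  refine ⟨locallyIntegrable_comp_fst h1, locallyIntegrable_comp_fst h2, fun φ hφ hs => ?_⟩
  have i1 : Integrable (fun z : ℝ × ℝ => (fderiv ℝ φ z (1, 0)) • γ z.1)
      ((volume : Measure ℝ).prod volume) :=
    (locallyIntegrable_comp_fst h1).integrable_smul_left_of_hasCompactSupport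
      ((hφ.continuous_fderiv (by simp)).clm_apply continuous_const) (hs.fderiv_apply (𝕜 := ℝ) _)
  have i2 : Integrable (fun z : ℝ × ℝ => φ z • γ' z.1) ((volume : Measure ℝ).prod volume) :=
    (locallyIntegrable_comp_fst h2).integrable_smul_left_of_hasCompactSupport hφ.continuous hs
  rw [Measure.volume_eq_prod, integral_prod_symm _ i1, integral_prod_symm _ i2, ← integral_neg]
  refine integral_congr_ae (.of_forall fun y => ?_)
  have h3 := hw (fun x => φ (x, y)) (hφ.comp (contDiff_id.prodMk contDiff_const))
    (HasCompactSupport.of_support_subset_isCompact (hs.isCompact.image continuous_fst)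
      fun x hx => ⟨(x, y), subset_tsupport _ hx, rfl⟩)
  have h4 : ∀ x, fderiv ℝ (fun x => φ (x, y)) x 1 = fderiv ℝ φ (x, y) (1, 0) := fun x => by
    have h5 : HasFDerivAt φ (fderiv ℝ φ (x, y)) (x, y) :=
      (hφ.differentiable (by simp) _).hasFDerivAt
    have h6 : HasDerivAt (fun x : ℝ => (x, y)) ((1, 0) : ℝ × ℝ) x :=
      (hasDerivAt_id x).prodMk (hasDerivAt_const x y)
    rw [fderiv_apply_one_eq_deriv]
    exact (h5.comp_hasDerivAt x h6).deriv
  simpa only [h4] using h3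

lemma isWeakDeriv_snd (h : LocallyIntegrable γ volume) :
    IsWeakDeriv ((0, 1) : ℝ × ℝ) (fun z => γ z.1) (fun _ => 0) := by
  refine ⟨locallyIntegrable_comp_fst h, locallyIntegrable_const _, fun φ hφ hs => ?_⟩
  have i1 : Integrable (fun z : ℝ × ℝ => (fderiv ℝ φ z (0, 1)) • γ z.1)
      ((volume : Measure ℝ).prod volume) :=
    (locallyIntegrable_comp_fst h).integrable_smul_left_of_hasCompactSupport
      ((hφ.continuous_fderiv (by simp)).clm_apply continuous_const) (hs.fderiv_apply (𝕜 := ℝ) _)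
  rw [Measure.volume_eq_prod, integral_prod _ i1]
  simp only [smul_zero, integral_zero, neg_zero]
  refine integral_eq_zero_of_ae (.of_forall fun x => ?_)
  change ∫ y, (fderiv ℝ φ (x, y)) (0, 1) • γ x = 0
  rw [integral_smul_const]
  have hφx : ContDiff ℝ ∞ fun y => φ (x, y) := hφ.comp (contDiff_const.prodMk contDiff_id)
  have hsx : HasCompactSupport fun y => φ (x, y) :=
    HasCompactSupport.of_support_subset_isCompact (hs.isCompact.image continuous_snd)
      fun y hy => ⟨(x, y), subset_tsupport _ hy, rfl⟩
  have h4 : ∀ y, HasDerivAt (fun y => φ (x, y)) (fderiv ℝ φ (x, y) (0, 1)) y := fun y => by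
    have h5 : HasFDerivAt φ (fderiv ℝ φ (x, y)) (x, y) :=
      (hφ.differentiable (by simp) _).hasFDerivAt
    exact h5.comp_hasDerivAt y ((hasDerivAt_const y x).prodMk (hasDerivAt_id y))
  have h7 : ∫ y, fderiv ℝ φ (x, y) (0, 1) = 0 := by
    refine integral_eq_zero_of_hasDerivAt_of_integrable h4 ?_
      (hφx.continuous.integrable_of_hasCompactSupport hsx)
    have h8 : (fun y => fderiv ℝ φ (x, y) (0, 1)) = deriv fun y => φ (x, y) :=
      funext fun y => (h4 y).deriv.symm
    rw [h8]
    exact (hφx.continuous_deriv (by simp)).integrable_of_hasCompactSupport hsx.deriv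
  rw [h7]; simp

lemma isWeakGradient_comp_fst (h : IsWeakDeriv (1 : ℝ) γ γ') :
    IsWeakGradient (fun x : Cylinder => γ x.1) ![fun x => γ' x.1, fun _ => 0] :=
  ⟨isWeakDeriv_fst h, isWeakDeriv_snd h.1⟩

/-- A one-dimensional competitor is a competitor on the cylinder. -/
lemma IsAdmissible1D.isAdmissible {a : ℝ} {um up : Plane} (h : IsAdmissible1D a um up γ) :
    IsAdmissible um up fun x : Cylinder => γ x.1 := by
  obtain ⟨hc, hd, hL, ha, hbot, htop⟩ := h
  have hw := weakDeriv_spec hd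
  have hG := isWeakGradient_comp_fst hw
  have h0 := weakGradient_ae_eq hG 0
  have h1 := weakGradient_ae_eq hG 1
  have hcu : Continuous fun x : Cylinder => γ x.1 := hc.comp continuous_fst
  refine ⟨⟨fun K hK => ?_, ⟨_, hG⟩, fun j => ?_, ?_⟩, γ, hc, ?_, hbot, htop⟩
  · obtain ⟨C, hC⟩ := hK.exists_bound_of_continuousOn hcu.continuousOn
    have : IsFiniteMeasure ((volume : Measure Cylinder).restrict K) :=
      ⟨by simpa using hK.measure_lt_top⟩
    exact MemLp.of_bound hcu.aestronglyMeasurable C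
      ((ae_restrict_mem hK.measurableSet).mono fun x hx => hC x hx)
  · fin_cases j
    · exact (memLp_congr_ae h0).2 (hL.comp_fst (volume : Measure UnitAddCircle))
    · exact (memLp_congr_ae h1).2 MemLp.zero
  · -- the first component is constant, so its weak derivative vanishes
    have h2 : ∀ᵐ t, weakDeriv γ t 0 = 0 := by
      obtain ⟨i1, i2, i3⟩ := hw.coord 0
      obtain ⟨j1, j2, j3⟩ := (HasACDeriv.const a).isWeakDerivReal
      refine ae_eq_of_integral_contDiff_smul_eq i2 j2 fun φ hφ hs => ?_
      have e1 := i3 φ hφ hs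
      have e2 := j3 φ hφ hs
      simp only [ha] at e1
      simp only [smul_eq_mul]
      linarith
    have h3 : ∀ᵐ x : Cylinder, weakDeriv γ x.1 0 = 0 :=
      (Measure.quasiMeasurePreserving_fst (μ := (volume : Measure ℝ))
        (ν := (volume : Measure UnitAddCircle))).ae h2
    filter_upwards [h0, h1, h3] with x e0 e1 e2
    rw [e0, e1]
    simpa using e2
  · refine .of_forall fun t => ?_
    simp [average, measureReal_def]

lemma energy_comp_fst {a : ℝ} {um up : Plane} (h : IsAdmissible1D a um up γ) {W : Plane → ℝ}
    (hW : Continuous W) : energy W (fun x : Cylinder => γ x.1) = energy1D W γ := by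
  have hw := weakDeriv_spec h.2.1
  have hG := isWeakGradient_comp_fst hw
  have hm : AEMeasurable (fun t : ℝ => ENNReal.ofReal ((1 / 2) * ‖weakDeriv γ t‖ ^ 2 + W (γ t)))
      volume :=
    ((((h.2.2.1.1.norm.aemeasurable.pow_const 2).const_mul (1 / 2)).add
      (hW.comp h.1).aemeasurable)).ennreal_ofReal
  rw [energy, energy1D]
  have e1 : ∫⁻ x : Cylinder, ENNReal.ofReal ((1 / 2) *
      (‖weakGradient (fun x : Cylinder => γ x.1) 0 x‖ ^ 2 +
        ‖weakGradient (fun x : Cylinder => γ x.1) 1 x‖ ^ 2) + W (γ x.1)) =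
      ∫⁻ x : Cylinder, ENNReal.ofReal ((1 / 2) * ‖weakDeriv γ x.1‖ ^ 2 + W (γ x.1)) := by
    refine lintegral_congr_ae ?_
    filter_upwards [weakGradient_ae_eq hG 0, weakGradient_ae_eq hG 1] with x h0 h1
    rw [h0, h1]
    simp
  rw [e1]
  have e2 := lintegral_prod (μ := (volume : Measure ℝ)) (ν := (volume : Measure UnitAddCircle))
    (fun x : Cylinder => ENNReal.ofReal ((1 / 2) * ‖weakDeriv γ x.1‖ ^ 2 + W (γ x.1)))
    (hm.comp_quasiMeasurePreserving Measure.quasiMeasurePreserving_fst)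
  refine e2.trans ?_
  simp

end Extend

/-! ### The optimal one-dimensional curve -/

/-- The curve `t ↦ (a, b tanh (|b| t))`. -/
noncomputable def layerCurve (a b t : ℝ) : Plane := !₂[a, profile b t]

section LayerCurve

variable {a b : ℝ}

lemma continuous_glPotential : Continuous glPotential := by
  unfold glPotential; fun_prop

lemma glPotential_eq (z : Plane) : glPotential z = (1 / 2) * (1 - z 0 ^ 2 - z 1 ^ 2) ^ 2 := by
  rw [glPotential, EuclideanSpace.real_norm_sq_eq, Fin.sum_univ_two]
  ring

lemma contDiff_layerCurve {n : WithTop ℕ∞} : ContDiff ℝ n (layerCurve a b) := by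
  refine contDiff_euclidean.2 fun i => ?_
  fin_cases i
  · exact contDiff_const
  · exact contDiff_profile

lemma exists_sign (b : ℝ) : ∃ s : ℝ, s ^ 2 = 1 ∧ s * b = |b| := by
  rcases le_total 0 b with h | h
  · exact ⟨1, by norm_num, by rw [abs_of_nonneg h, one_mul]⟩
  · exact ⟨-1, by norm_num, by rw [abs_of_nonpos h]; ring⟩

lemma tendsto_plane {l : Filter ℝ} {v : ℝ → ℝ} {c : ℝ} (h : Tendsto v l (𝓝 c)) :
    Tendsto (fun t => (!₂[a, v t] : Plane)) l (𝓝 !₂[a, c]) := by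
  have : Continuous fun c : ℝ => (!₂[a, c] : Plane) := by fun_prop
  exact (this.tendsto c).comp h

/-- The layer curve is a competitor, and its energy is `4/3 |b|³`. -/
lemma layerCurve_admissible_energy (hab : a ^ 2 + b ^ 2 = 1) :
    IsAdmissible1D a !₂[a, -b] !₂[a, b] (layerCurve a b) ∧
      energy1D glPotential (layerCurve a b) = ENNReal.ofReal (4 / 3 * |b| ^ 3) := by
  obtain ⟨s, hs, hsb⟩ := exists_sign b
  have hpc : Continuous (profile b) := (contDiff_profile (n := 0)).continuous
  have hw : IsWeakDeriv (1 : ℝ) (layerCurve a b)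
      (fun t => !₂[0, s * (b ^ 2 - profile b t ^ 2)]) := by
    refine isWeakDeriv_of_hasDerivAt (fun t => ?_) (by fun_prop)
    have h : HasDerivAt (fun t => ![a, profile b t]) ![0, s * (b ^ 2 - profile b t ^ 2)] t := by
      refine hasDerivAt_pi.2 fun i => ?_
      fin_cases i
      · exact hasDerivAt_const t a
      · exact hasDerivAt_profile hs hsb t
    exact (PiLp.hasFDerivAt_toLp (𝕜 := ℝ) 2 ![a, profile b t]).comp_hasDerivAt t h
  have hae := weakDeriv_ae_eq hw
  obtain ⟨hi, he⟩ := hasIntegral_profile hs hsb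
  have hnorm : ∀ t, ‖(!₂[0, s * (b ^ 2 - profile b t ^ 2)] : Plane)‖ ^ 2 =
      (b ^ 2 - profile b t ^ 2) ^ 2 := fun t => by
    rw [EuclideanSpace.real_norm_sq_eq, Fin.sum_univ_two]
    simp [mul_pow, hs]
  refine ⟨⟨(contDiff_layerCurve (n := 0)).continuous, ⟨_, hw⟩, (memLp_congr_ae hae).2 ?_,
    fun t => rfl, tendsto_plane tendsto_profile_atBot, tendsto_plane tendsto_profile_atTop⟩, ?_⟩
  · rw [memLp_two_iff_integrable_sq_norm (by
      exact (by fun_prop : Continuous fun t => (!₂[0, s * (b ^ 2 - profile b t ^ 2)] :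
        Plane)).aestronglyMeasurable)]
    simpa only [hnorm] using hi
  · rw [energy1D, ← he, ofReal_integral_eq_lintegral_ofReal hi (.of_forall fun t => sq_nonneg _)]
    refine lintegral_congr_ae ?_
    filter_upwards [hae] with t ht
    rw [ht, hnorm, glPotential_eq]
    congr 1
    simp only [layerCurve, PiLp.toLp_apply, Matrix.cons_val_zero, Matrix.cons_val_one]
    rw [show 1 - a ^ 2 = b ^ 2 by linarith]
    ring

end LayerCurve

/-! ### The sharp lower bound and its equality case -/

lemma memLp_coord {X : Type*} [MeasurableSpace X] {μ : Measure X} {F : X → Plane}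
    (h : MemLp F 2 μ) (i : Fin 2) : MemLp (fun x => F x i) 2 μ :=
  (EuclideanSpace.proj (𝕜 := ℝ) i).comp_memLp' h

lemma locSq_of_memLp_compact {F : Cylinder → Plane}
    (h : ∀ K : Set Cylinder, IsCompact K → MemLp F 2 (volume.restrict K)) (i : Fin 2) :
    LocSq fun x => F x i := by
  have h1 : LocallyIntegrable (fun x => F x i ^ 2) volume :=
    locallyIntegrable_iff.2 fun K hK => (memLp_coord (h K hK) i).integrable_sq
  have h2 : LocallyIntegrable (fun x => F x i) volume := locallyIntegrable_iff.2 fun K hK => by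
    have : IsFiniteMeasure ((volume : Measure Cylinder).restrict K) :=
      ⟨by simpa using hK.measure_lt_top⟩
    exact (memLp_coord (h K hK) i).integrable (by norm_num)
  exact ⟨h2.aestronglyMeasurable, h1⟩

/-- The means of the coordinates of a map with given end states converge. -/
lemma HasEndStates.tendsto {u : Cylinder → Plane} {um up : Plane} (h : HasEndStates u um up)
    (hu : ∀ i, LocallyIntegrable (fun x => u x i) volume) (i : Fin 2) :
    ∃ c : ℝ → ℝ, Continuous c ∧ (∀ᵐ t, c t = ∫ y, u (t, y) i) ∧
      Tendsto c atBot (𝓝 (um i)) ∧ Tendsto c atTop (𝓝 (up i)) := by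
  obtain ⟨c, hc, hca, hbot, htop⟩ := h
  have hP : Continuous fun z : Plane => z i := by fun_prop
  refine ⟨fun t => c t i, hP.comp hc, ?_, (hP.tendsto _).comp hbot, (hP.tendsto _).comp htop⟩
  filter_upwards [hca, ae_integrable_circle (hu 0), ae_integrable_circle (hu 1)] with t ht h0 h1
  have hi : Integrable fun y : UnitAddCircle => u (t, y) := by
    refine Integrable.of_eval_piLp fun j => ?_
    fin_cases j
    · exact h0
    · exact h1
  rw [ht, average]
  exact ((EuclideanSpace.proj (𝕜 := ℝ) i : Plane →L[ℝ] ℝ).integral_comp_comm hi).symm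

lemma tendsto_inf_ae {l : Filter ℝ} {c q : ℝ → ℝ} {L : ℝ} (h : Tendsto c l (𝓝 L))
    (hq : ∀ᵐ t, c t = q t) : Tendsto q (l ⊓ ae volume) (𝓝 L) :=
  (h.mono_left inf_le_left).congr' (mem_inf_of_right hq)

lemma ae_const_of_hasACDeriv_zero {q : ℝ → ℝ} {q' : ℝ → ℝ} (h : HasACDeriv q q')
    (h0 : ∀ᵐ t, q' t = 0) : ∃ m, ∀ᵐ t, q t = m := by
  obtain ⟨-, c, hc⟩ := h.congr (g' := fun _ => 0) .rfl h0
  exact ⟨c, by simpa using hc⟩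

section Rigidity

variable {a b s : ℝ} {f f₁ f₂ g g₁ g₂ : Cylinder → ℝ}

/-- The equality case: a map with `∂₁ u₁ = ∂₂ u₂ = 0` and `∂₁ u₂ + ∂₂ u₁ = ±(1 - |u|²)` joining the
end states is a translate of the profile. Averaging the last equation over the circle gives
`v' = ±(1 - m - v²)` for the mean `v` of `u₂`, where the mean square `m` of `u₁` is constant. The
end states force `m = a²`, so `u₁` has zero variance. -/
theorem rigidity (hab : a ^ 2 + b ^ 2 = 1) (hs : s ^ 2 = 1) (hsb : s * b = |b|)
    (F : HasACGradient f f₁ f₂) (G : HasACGradient g g₁ g₂) (hf : LocSq f) (hg : LocSq g)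
    (hf₁ : LocSq f₁) (hg₁ : LocSq g₁) (hf₂ : LocSq f₂)
    (h1 : ∀ᵐ x, f₁ x = 0) (h2 : ∀ᵐ x, g₂ x = 0)
    (h3 : ∀ᵐ x, g₁ x + f₂ x = s * (1 - f x ^ 2 - g x ^ 2)) {c v : ℝ → ℝ}
    (hc : ∀ᵐ t, c t = ∫ y, f (t, y)) (hctop : Tendsto c atTop (𝓝 a))
    (hv : ∀ᵐ t, v t = ∫ y, g (t, y)) (hvc : Continuous v)
    (hvbot : Tendsto v atBot (𝓝 (-b))) (hvtop : Tendsto v atTop (𝓝 b)) :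
    ∃ τ, ∀ᵐ x : Cylinder, f x = a ∧ g x = profile b (x.1 + τ) := by
  have slice : ∀ {p : Cylinder → Prop}, (∀ᵐ x, p x) → ∀ᵐ t : ℝ, ∀ᵐ y : UnitAddCircle, p (t, y) :=
    fun h => Measure.ae_ae_of_ae_prod (μ := (volume : Measure ℝ)) h
  -- `g` does not depend on the vertical variable
  have hgv : ∀ᵐ t : ℝ, ∀ᵐ y : UnitAddCircle, g (t, y) = v t := by
    filter_upwards [G.snd, ae_integrable_circle hg.locallyIntegrable, slice h2, hv]
      with t h4 h5 h6 h7
    have h8 : ∫ y, |g₂ (t, y)| = 0 :=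
      integral_eq_zero_of_ae (by filter_upwards [h6] with y hy; simp [hy])
    filter_upwards [HasACDeriv.abs_sub_integral_circle_le (q := fun y => g (t, y))
      (q' := fun y => g₂ (t, y)) h4 h5] with y hy
    rw [h8] at hy
    rw [h7]
    exact sub_eq_zero.1 (abs_eq_zero.1 (le_antisymm hy (abs_nonneg _)))
  -- the first two moments of `f` on the circle do not depend on the slice
  have hmean : ∀ᵐ t : ℝ, ∫ y, f (t, y) = a := by
    have h4 := hasACDeriv_integral (F := f) (F' := f₁) hf.locallyIntegrable hf₁.locallyIntegrable
      F.fst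
    obtain ⟨m, hm⟩ := ae_const_of_hasACDeriv_zero h4 (by
      filter_upwards [slice h1] with t ht
      exact integral_eq_zero_of_ae ht)
    have h5 := tendsto_inf_ae hctop hc
    have h6 : Tendsto (fun t => ∫ y, f (t, y)) (atTop ⊓ ae volume) (𝓝 m) :=
      tendsto_inf_ae tendsto_const_nhds (hm.mono fun t ht => ht.symm)
    rw [tendsto_nhds_unique h5 h6]
    exact hm
  obtain ⟨m, hm⟩ : ∃ m, ∀ᵐ t : ℝ, ∫ y, f (t, y) ^ 2 = m := by
    have h4 : HasACDeriv (fun t => ∫ y, f (t, y) ^ 2)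
        (fun t => ∫ y, 2 * (f (t, y) * f₁ (t, y))) := by
      refine hasACDeriv_integral (F := fun x => f x ^ 2) (F' := fun x => 2 * (f x * f₁ x)) hf.2
        ((hf.mul hf₁).smul (2 : ℝ)) ?_
      filter_upwards [F.fst] with y hy
      exact (hy.mul hy).congr (.of_forall fun t => by simp only; ring)
        (.of_forall fun t => by simp only; ring)
    refine ae_const_of_hasACDeriv_zero h4 ?_
    filter_upwards [slice h1] with t ht
    exact integral_eq_zero_of_ae (by filter_upwards [ht] with y hy; simp [hy])
  -- the averaged equation
  have hode : ∀ t, HasDerivAt v (s * (1 - m - v t ^ 2)) t := by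
    have h4 := hasACDeriv_integral (F := g) (F' := g₁) hg.locallyIntegrable hg₁.locallyIntegrable
      G.fst
    have h5 : ∀ᵐ t : ℝ, ∫ y, g₁ (t, y) = s * (1 - m - v t ^ 2) := by
      filter_upwards [slice h3, F.snd, ae_integrable_circle hg₁.locallyIntegrable,
        ae_integrable_circle hf₂.locallyIntegrable, ae_integrable_circle hf.2, hgv, hm]
        with t e1 e2 e3 e4 e5 e6 e7
      have e8 := HasACDeriv.integral_circle_eq_zero (q := fun y => f (t, y))
        (q' := fun y => f₂ (t, y)) e2
      rw [← add_zero (∫ y, g₁ (t, y)), ← e8, ← integral_add e3 e4, ← e7]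
      have e9 : ∫ y, (g₁ (t, y) + f₂ (t, y)) = ∫ y, s * ((1 - v t ^ 2) - f (t, y) ^ 2) := by
        refine integral_congr_ae ?_
        filter_upwards [e1, e6] with y p1 p2
        rw [p1, p2]; ring
      rw [e9, integral_const_mul, integral_sub (integrable_const _) e5]
      simp only [integral_const, measureReal_def, UnitAddCircle.measure_univ, ENNReal.toReal_one,
        smul_eq_mul, one_mul]
      ring
    obtain ⟨-, k, hk⟩ := h4.congr (hv.mono fun t ht => ht.symm) h5
    have hcont : Continuous fun t => s * (1 - m - v t ^ 2) := by fun_prop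
    have h6 : v = fun t => k + ∫ r in (0 : ℝ)..t, s * (1 - m - v r ^ 2) :=
      (hvc.ae_eq_iff_eq volume
        (HasACDeriv.continuous_primitive hcont.locallyIntegrable k)).1 hk
    intro t
    have h7 := (intervalIntegral.integral_hasDerivAt_right (hcont.intervalIntegrable 0 t)
      (hcont.stronglyMeasurableAtFilter _ _) hcont.continuousAt).const_add k
    rw [← h6] at h7
    exact h7
  have hma : m = a ^ 2 := by
    have h4 := eq_zero_of_tendsto_deriv hode (((hvtop.pow 2).const_sub (1 - m)).const_mul s) hvtop
    have hs0 : s ≠ 0 := by rintro rfl; norm_num at hs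
    have h5 : 1 - m - b ^ 2 = 0 := by simpa [hs0] using h4
    linarith
  obtain ⟨τ, hτ⟩ := exists_eq_profile hs hsb (v := v) (fun t => by
    have := hode t
    rwa [hma, show 1 - a ^ 2 = b ^ 2 by linarith] at this) hvbot hvtop
  refine ⟨τ, ?_⟩
  have hfa : ∀ᵐ t : ℝ, ∀ᵐ y : UnitAddCircle, f (t, y) - a = 0 := by
    filter_upwards [hmean, hm, ae_integrable_circle hf.locallyIntegrable,
      ae_integrable_circle hf.2] with t e1 e2 e3 e4
    have e5 : ∀ y : UnitAddCircle, (f (t, y) - a) ^ 2 = f (t, y) ^ 2 - (2 * a) * f (t, y) + a ^ 2 :=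
      fun y => by ring
    have i1 : Integrable fun y : UnitAddCircle => f (t, y) ^ 2 - (2 * a) * f (t, y) :=
      e4.sub (e3.const_mul _)
    have e6 : ∫ y : UnitAddCircle, (f (t, y) - a) ^ 2 = 0 := by
      simp_rw [e5]
      rw [integral_add i1 (integrable_const _), integral_sub e4 (e3.const_mul _),
        integral_const_mul, e1, e2, hma]
      simp only [integral_const, measureReal_def, UnitAddCircle.measure_univ, ENNReal.toReal_one,
        smul_eq_mul, one_mul]
      ring
    have i2 : Integrable fun y : UnitAddCircle => (f (t, y) - a) ^ 2 := by
      simp_rw [e5]; exact i1.add (integrable_const _)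
    filter_upwards [(integral_eq_zero_iff_of_nonneg (fun y => sq_nonneg _) i2).1 e6] with y hy
    simpa using hy
  have hga : ∀ᵐ t : ℝ, ∀ᵐ y : UnitAddCircle, g (t, y) - profile b (t + τ) = 0 := by
    filter_upwards [hgv] with t ht
    filter_upwards [ht] with y hy
    rw [hy, hτ, sub_self]
  have hpc : Continuous (profile b) := (contDiff_profile (n := 0)).continuous
  have k1 := ae_ae_eq_zero_comm (μ := (volume : Measure ℝ)) (ν := (volume : Measure UnitAddCircle))
    (k := fun x => f x - a) (hf.1.sub aestronglyMeasurable_const) hfa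
  have k2 := ae_ae_eq_zero_comm (μ := (volume : Measure ℝ)) (ν := (volume : Measure UnitAddCircle))
    (k := fun x => g x - profile b (x.1 + τ)) (hg.1.sub (by
      exact (hpc.comp (continuous_fst.add continuous_const)).aestronglyMeasurable)) hga
  filter_upwards [k1, k2] with x p1 p2
  exact ⟨sub_eq_zero.1 p1, sub_eq_zero.1 p2⟩

end Rigidity

/-- Every competitor has energy at least `4/3 |b|³`, and only the translates of the layer curve
attain this value. -/
theorem energy_lower_bound {a b : ℝ} (hab : a ^ 2 + b ^ 2 = 1) {u : Cylinder → Plane}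
    (hu : IsAdmissible !₂[a, -b] !₂[a, b] u) :
    ENNReal.ofReal (4 / 3 * |b| ^ 3) ≤ energy glPotential u ∧
      (energy glPotential u ≤ ENNReal.ofReal (4 / 3 * |b| ^ 3) →
        ∃ τ, ∀ᵐ x : Cylinder, u x = layerCurve a b (x.1 + τ)) := by
  rcases eq_or_ne (energy glPotential u) ⊤ with htop | hfin
  · rw [htop]
    exact ⟨le_top, fun h => absurd h (not_le.2 ENNReal.ofReal_lt_top)⟩
  obtain ⟨s, hs, hsb⟩ := exists_sign b
  obtain ⟨⟨hK, hD, hL, hdiv⟩, hend⟩ := hu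
  have hG := weakGradient_spec hD
  set D := weakGradient u with hDdef
  set f : Cylinder → ℝ := fun x => u x 0 with hf_def
  set g : Cylinder → ℝ := fun x => u x 1 with hg_def
  set f₁ : Cylinder → ℝ := fun x => D 0 x 0 with hf₁_def
  set f₂ : Cylinder → ℝ := fun x => D 1 x 0 with hf₂_def
  set g₁ : Cylinder → ℝ := fun x => D 0 x 1 with hg₁_def
  set g₂ : Cylinder → ℝ := fun x => D 1 x 1 with hg₂_def
  have F : HasACGradient f f₁ f₂ := hG.hasACGradient 0
  have G : HasACGradient g g₁ g₂ := hG.hasACGradient 1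
  have hf : LocSq f := locSq_of_memLp_compact hK 0
  have hg : LocSq g := locSq_of_memLp_compact hK 1
  have hf₁ : MemLp f₁ 2 volume := memLp_coord (hL 0) 0
  have hf₂ : MemLp f₂ 2 volume := memLp_coord (hL 1) 0
  have hg₁ : MemLp g₁ 2 volume := memLp_coord (hL 0) 1
  have hg₂ : MemLp g₂ 2 volume := memLp_coord (hL 1) 1
  have huL : ∀ i, LocallyIntegrable (fun x => u x i) volume := fun i =>
    (locSq_of_memLp_compact hK i).locallyIntegrable
  obtain ⟨c, -, hca, hcbot, hctop⟩ := hend.tendsto huL 0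
  obtain ⟨v, hvc, hva, hvbot, hvtop⟩ := hend.tendsto huL 1
  simp only [Matrix.cons_val_zero, Matrix.cons_val_one] at hcbot hctop hvbot hvtop
  -- the energy density in coordinates
  set ε : Cylinder → ℝ := fun x => (1 / 2) * (f₁ x ^ 2 + g₁ x ^ 2 + (f₂ x ^ 2 + g₂ x ^ 2)) +
    (1 / 2) * (1 - f x ^ 2 - g x ^ 2) ^ 2 with hε
  have hεeq : ∀ x, (1 / 2) * (‖D 0 x‖ ^ 2 + ‖D 1 x‖ ^ 2) + glPotential (u x) = ε x := fun x => by
    rw [glPotential_eq, EuclideanSpace.real_norm_sq_eq, EuclideanSpace.real_norm_sq_eq,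
      Fin.sum_univ_two, Fin.sum_univ_two]
  have hε0 : ∀ x, 0 ≤ ε x := fun x => by positivity
  have hρm : AEStronglyMeasurable (fun x => 1 - f x ^ 2 - g x ^ 2) volume :=
    (aestronglyMeasurable_const.sub (hf.1.pow 2)).sub (hg.1.pow 2)
  have hεm : AEStronglyMeasurable ε volume :=
    ((((hf₁.1.pow 2).add (hg₁.1.pow 2)).add ((hf₂.1.pow 2).add (hg₂.1.pow 2))).const_mul _).add
      ((hρm.pow 2).const_mul _)
  have hE : energy glPotential u = ∫⁻ x, ENNReal.ofReal (ε x) := by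
    rw [energy]; simp_rw [← hDdef, hεeq]
  have hεi : Integrable ε volume := by
    refine ⟨hεm, ?_⟩
    rw [hasFiniteIntegral_iff_ofReal (.of_forall hε0), ← hE]
    exact lt_top_iff_ne_top.2 hfin
  have hE' : energy glPotential u = ENNReal.ofReal (∫ x, ε x) := by
    rw [hE, ofReal_integral_eq_lintegral_ofReal hεi (.of_forall hε0)]
  have hρ : MemLp (fun x => 1 - f x ^ 2 - g x ^ 2) 2 volume := by
    refine (memLp_two_iff_integrable_sq hρm).2 ?_
    refine (hεi.const_mul 2).mono' (hρm.pow 2) (.of_forall fun x => ?_)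
    rw [Real.norm_eq_abs, abs_of_nonneg (by positivity)]
    simp only [hε]
    nlinarith [sq_nonneg (f₁ x), sq_nonneg (g₁ x), sq_nonneg (f₂ x), sq_nonneg (g₂ x)]
  -- the two null Lagrangians
  have hA := tendsto_inf_ae hcbot hca
  have hA' := tendsto_inf_ae hctop hca
  have hB := tendsto_inf_ae hvbot hva
  have hB' := tendsto_inf_ae hvtop hva
  have hent := integral_entropy_production F G hf hg hf₁ hf₂ hg₁ hg₂ hρ hdiv hA hA' hB hB'
  have hjac := integral_jacobian F G hf hg hf₁ hf₂ hg₁ hg₂ hA hA' hB hB'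
  have iq : Integrable (fun x => (1 - f x ^ 2 - g x ^ 2) * (g₁ x + f₂ x)) volume :=
    hρ.integrable_mul (hg₁.add hf₂)
  have ij : Integrable (fun x => f₁ x * g₂ x - f₂ x * g₁ x) volume :=
    (hf₁.integrable_mul hg₂).sub (hf₂.integrable_mul hg₁)
  -- the part of the energy density that remains is a sum of squares
  set δ : Cylinder → ℝ := fun x =>
    ε x - s * ((1 - f x ^ 2 - g x ^ 2) * (g₁ x + f₂ x)) - (f₁ x * g₂ x - f₂ x * g₁ x) with hδ
  have hδi : Integrable δ volume := (hεi.sub (iq.const_mul s)).sub ij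
  have hδint : ∫ x, δ x = (∫ x, ε x) - 4 / 3 * |b| ^ 3 := by
    have e1 := integral_sub (hεi.sub (iq.const_mul s)) ij
    have e2 := integral_sub hεi (iq.const_mul s)
    simp only [Pi.sub_apply] at e1
    rw [integral_const_mul, hent] at e2
    rw [e2, hjac, sub_zero] at e1
    refine e1.trans ?_
    have hb3 : s * b ^ 3 = |b| ^ 3 := by
      rw [show |b| ^ 3 = |b| ^ 2 * |b| by ring, sq_abs, ← hsb]; ring
    rw [← hb3]
    simp only [entropy]
    linear_combination (2 * s * b) * hab
  have hδeq : ∀ᵐ x, δ x =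
      (1 / 2) * (g₁ x + f₂ x - s * (1 - f x ^ 2 - g x ^ 2)) ^ 2 + 2 * f₁ x ^ 2 := by
    filter_upwards [hdiv] with x hx
    have hx' : g₂ x = -f₁ x := by linarith
    simp only [hδ, hε]
    rw [hx']
    linear_combination (-(1 / 2) * (1 - f x ^ 2 - g x ^ 2) ^ 2) * hs
  have hδ0 : 0 ≤ᵐ[volume] δ := by
    filter_upwards [hδeq] with x hx
    rw [hx]; simp only [Pi.zero_apply]; positivity
  have hδnn : 0 ≤ ∫ x, δ x := integral_nonneg_of_ae hδ0
  refine ⟨?_, fun hle => ?_⟩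
  · rw [hE']
    exact ENNReal.ofReal_le_ofReal (by linarith)
  · rw [hE', ENNReal.ofReal_le_ofReal_iff (by positivity)] at hle
    have hzero := (integral_eq_zero_iff_of_nonneg_ae hδ0 hδi).1 (by linarith)
    have hall : ∀ᵐ x, f₁ x = 0 ∧ g₁ x + f₂ x = s * (1 - f x ^ 2 - g x ^ 2) := by
      filter_upwards [hzero, hδeq] with x h1 h2
      rw [h1, Pi.zero_apply] at h2
      have p1 := sq_nonneg (g₁ x + f₂ x - s * (1 - f x ^ 2 - g x ^ 2))
      have p2 := sq_nonneg (f₁ x)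
      refine ⟨pow_eq_zero_iff two_ne_zero |>.1 (by linarith), ?_⟩
      exact sub_eq_zero.1 (pow_eq_zero_iff two_ne_zero |>.1 (by linarith))
    obtain ⟨τ, hτ⟩ := rigidity hab hs hsb F G hf hg (.of_memLp hf₁) (.of_memLp hg₁) (.of_memLp hf₂)
      (hall.mono fun x h => h.1)
      (by filter_upwards [hall, hdiv] with x h1 h2; linarith [h1.1])
      (hall.mono fun x h => h.2) hca hctop hva hvc hvbot hvtop
    refine ⟨τ, ?_⟩
    filter_upwards [hτ] with x hx
    ext i
    fin_cases i
    · exact hx.1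
    · exact hx.2

end Layer

theorem mainTheorem2 (a b : ℝ) (hab : a ^ 2 + b ^ 2 = 1) :
    ∃ g : ℝ → Layer.Plane,
      ContDiff ℝ 2 g ∧
      Layer.IsMinimizer1D Layer.glPotential a !₂[a, -b] !₂[a, b] g ∧
      (∀ h : ℝ → Layer.Plane,
        Layer.IsMinimizer1D Layer.glPotential a !₂[a, -b] !₂[a, b] h →
          ∃ τ : ℝ, ∀ t : ℝ, h t = g (t + τ)) ∧
      ∀ u : Layer.Cylinder → Layer.Plane,
        Layer.IsGlobalMinimizer Layer.glPotential !₂[a, -b] !₂[a, b] u →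
          ∃ τ : ℝ, ∀ᵐ x : Layer.Cylinder, u x = g (x.1 + τ) := by
  open Layer in
  obtain ⟨hadm, hen⟩ := layerCurve_admissible_energy hab
  have hen2 := energy_comp_fst hadm continuous_glPotential
  refine ⟨layerCurve a b, contDiff_layerCurve, ⟨hadm, fun η hη => ?_⟩, fun h hh => ?_,
    fun u hu => ?_⟩
  · rw [hen, ← energy_comp_fst hη continuous_glPotential]
    exact (energy_lower_bound hab hη.isAdmissible).1
  · have h1 := hh.2 _ hadm
    rw [hen, ← energy_comp_fst hh.1 continuous_glPotential] at h1
    obtain ⟨τ, hτ⟩ := (energy_lower_bound hab hh.1.isAdmissible).2 h1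
    refine ⟨τ, fun t => ?_⟩
    have h2 : ∀ᵐ t : ℝ, h t = layerCurve a b (t + τ) := by
      filter_upwards [Measure.ae_ae_of_ae_prod (μ := (volume : Measure ℝ)) hτ] with t ht
      exact ht.exists.choose_spec
    have hc : Continuous (layerCurve a b) := (contDiff_layerCurve (n := 0)).continuous
    exact congrFun ((hh.1.1.ae_eq_iff_eq volume
      (hc.comp (continuous_id.add continuous_const))).1 h2) t
  · refine (energy_lower_bound hab hu.1).2 ?_
    rw [← hen, ← hen2]
    exact hu.2 _ hadm.isAdmissible
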